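/- Conventions. A double category has vertical morphisms $f\colon A\to C$ (composed strictly, $\circ$), horizontal morphisms $J\colon A\nrightarrow B$ (composed, $\odot$, associatively and unitally up to coherent invertible cells, with units $1_A$), and square cells with horizontal source and target $J\colon A\nrightarrow B$, $L\colon C\nrightarrow D$ and vertical source and target $f\colon A\to C$, $g\colon B\to D$. Its objects, vertical morphisms and vertical cells (cells whose horizontal source and target are units) form the vertical $2$-category $V(\mathcal K)$; the unit cell of $f$ is denoted $1_f$. A cell is cartesian if every cell with the same horizontal target whose vertical source and target factor through those of the given cell factors uniquely through it. An equipment is a double category in which all restrictions (cartesian cells with prescribed vertical source and target and prescribed horizontal target) exist; the companion $j_*\colon A\nrightarrow B$ of $j\colon A\to B$ is the restriction of $1_B$ along $j$ and $\mathrm{id}_B$. A cell $\eta$ with horizontal source $J\colon A\nrightarrow B$, horizontal target $1_M$, vertical source $d\colon A\to M$ and vertical target $l\colon B\to M$ defines $l$ as the left Kan extension of $d$ along $J$ if every cell $\phi$ with horizontal source $J$, horizontal target $1_M$, vertical source $d$ and arbitrary vertical target $k\colon B\to M$ factors as $\phi=\eta\odot\psi$ for a unique vertical cell $\psi\colon l\Rightarrow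 k$ (up to unit isomorphisms). It defines $l$ as the pointwise left Kan extension if, for every $H\colon B\nrightarrow C$ and $k\colon C\to M$, every cell $\phi$ with horizontal source $J\odot H$, horizontal target $1_M$, vertical source $d$ and vertical target $k$ factors as $\phi=\eta\odot\psi$ for a unique cell $\psi$ with horizontal source $H$, horizontal target $1_M$, vertical source $l$ and vertical target $k$. Let $T=(T,\mu,\iota)$ be a normal lax double monad on an equipment $\mathcal K$: $T$ is a lax double functor whose unitor cells $1_{TA}\Rightarrow T1_A$ are identities, and $\mu\colon T^2\Rightarrow T$ and $\iota\colon\mathrm{id}\Rightarrow T$ are double transformations satisfying the monad axioms. Assume that the $2$-monad to which $T$ restricts on $V(\mathcal K)$ is colax-idempotent, that is, every morphism between the underlying objects of strict $T$-algebras carries exactly one structure of a colax $T$-morphism. A pseudo $T$-algebra structure on $M$ is a triple $(m,\bar m,\hat m)$ of a morphism $m\colon TM\to M$ and invertible vertical cells $\bar m\colon m\circ Tm\Rightarrow m\circ\mu_M$ and $\hat m\colon \mathrm{id}_M\Rightarrow m\circ\iota_M$ satisfying the usual coherence axioms. Theorem. Let $(a,\bar a,\hat a)$, $(b,\bar b,\hat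 b)$ and $(m,\bar m,\hat m)$ be pseudo $T$-algebra structures on objects $A$, $B$ and $M$ of $\mathcal K$, let $j\colon A\to B$, $d\colon A\to M$ and $l\colon B\to M$ be vertical morphisms, and let $\eta$ be a cell with horizontal source $j_*$, horizontal target $1_M$, vertical source $d$ and vertical target $l$ that defines $l$ as the pointwise left Kan extension of $d$ along $j_*$. Then there are unique vertical cells $\bar d\colon d\circ a\Rightarrow m\circ Td$ and $\bar l\colon l\circ b\Rightarrow m\circ Tl$ that make $d$ and $l$ into colax $T$-morphisms. If $\bar d$ is invertible, then $\bar l$ is invertible if and only if the vertical composite $1_m\circ T\eta$ defines $m\circ Tl$ as the left Kan extension of $m\circ Td$ along $Tj_*$. -/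

import Mathlib

open CategoryTheory

universe z w v u z' w' v' u'

/-- The data of a (pseudo) double category: objects and vertical morphisms form a category
(composition written `f ≫ g`), `Hor A B` are the horizontal morphisms, and `Cell J f g L` are the
cells with horizontal source `J : A ⇸ B`, horizontal target `L : C ⇸ D`, vertical source
`f : A ⟶ C` and vertical target `g : B ⟶ D`. Horizontal composition is in diagrammatic order. -/
class DoubleCategoryStruct (K : Type u) extends Category.{v} K where
  /-- Horizontal morphisms. -/
  Hor : K → K → Type w
  /-- Cells. -/
  Cell : ∀ {A B C D : K}, Hor A B → (A ⟶ C) → (B ⟶ D) → Hor C D → Type z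
  /-- Vertical identity cell. -/
  vid : ∀ {A B : K} (J : Hor A B), Cell J (𝟙 A) (𝟙 B) J
  /-- Vertical composition of cells. -/
  vcomp : ∀ {A B C D E F : K} {J : Hor A B} {L : Hor C D} {N : Hor E F}
    {f : A ⟶ C} {g : B ⟶ D} {h : C ⟶ E} {k : D ⟶ F},
    Cell J f g L → Cell L h k N → Cell J (f ≫ h) (g ≫ k) N
  /-- Horizontal unit. -/
  hunit : ∀ A : K, Hor A A
  /-- Horizontal composition of horizontal morphisms. -/
  hcomp : ∀ {A B C : K}, Hor A B → Hor B C → Hor A C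
  /-- The horizontal unit cell of a vertical morphism. -/
  cunit : ∀ {A C : K} (f : A ⟶ C), Cell (hunit A) f f (hunit C)
  /-- Horizontal composition of cells. -/
  ccomp : ∀ {A B C A' B' C' : K} {J : Hor A B} {H : Hor B C} {J' : Hor A' B'} {H' : Hor B' C'}
    {f : A ⟶ A'} {g : B ⟶ B'} {h : C ⟶ C'},
    Cell J f g J' → Cell H g h H' → Cell (hcomp J H) f h (hcomp J' H')
  /-- Associator and its inverse. -/
  hassoc : ∀ {A B C D : K} (J : Hor A B) (H : Hor B C) (L : Hor C D),
    Cell (hcomp (hcomp J H) L) (𝟙 A) (𝟙 D) (hcomp J (hcomp H L))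
  hassocInv : ∀ {A B C D : K} (J : Hor A B) (H : Hor B C) (L : Hor C D),
    Cell (hcomp J (hcomp H L)) (𝟙 A) (𝟙 D) (hcomp (hcomp J H) L)
  /-- Left unitor and its inverse. -/
  leftUnitor : ∀ {A B : K} (J : Hor A B), Cell (hcomp (hunit A) J) (𝟙 A) (𝟙 B) J
  leftUnitorInv : ∀ {A B : K} (J : Hor A B), Cell J (𝟙 A) (𝟙 B) (hcomp (hunit A) J)
  /-- Right unitor and its inverse. -/
  rightUnitor : ∀ {A B : K} (J : Hor A B), Cell (hcomp J (hunit B)) (𝟙 A) (𝟙 B) J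
  rightUnitorInv : ∀ {A B : K} (J : Hor A B), Cell J (𝟙 A) (𝟙 B) (hcomp J (hunit B))

namespace DoubleCategoryStruct

variable {K : Type u} [DoubleCategoryStruct.{z, w, v} K]

/-- Transport of a cell along equalities of its four boundary morphisms. -/
def recast {A B C D : K} {J J' : Hor A B} {f f' : A ⟶ C} {g g' : B ⟶ D} {L L' : Hor C D}
    (hJ : J = J') (hf : f = f') (hg : g = g') (hL : L = L') (α : Cell J f g L) :
    Cell J' f' g' L' :=
  cast (by rw [hJ, hf, hg, hL]) α

/-- The vertical composite of a horizontal cell (one with identities as vertical source and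
target) followed by a cell, as a cell with the evident boundary. -/
def pre {A B C D : K} {J J' : Hor A B} {f : A ⟶ C} {g : B ⟶ D} {L : Hor C D}
    (σ : Cell J' (𝟙 A) (𝟙 B) J) (α : Cell J f g L) : Cell J' f g L :=
  recast rfl (Category.id_comp f) (Category.id_comp g) rfl (vcomp σ α)

/-- The vertical composite of a cell followed by a horizontal cell, as a cell with the evident
boundary. -/
def post {A B C D : K} {J : Hor A B} {f : A ⟶ C} {g : B ⟶ D} {L L' : Hor C D}
    (α : Cell J f g L) (σ : Cell L (𝟙 C) (𝟙 D) L') : Cell J f g L' :=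
  recast rfl (Category.comp_id f) (Category.comp_id g) rfl (vcomp α σ)

end DoubleCategoryStruct

open DoubleCategoryStruct in
/-- The axioms of a (pseudo) double category: vertical composition is strictly associative and
unital, horizontal composition is functorial, and associative and unital up to coherent invertible
horizontal cells. -/
structure DoubleCategoryLaws (K : Type u) [DoubleCategoryStruct.{z, w, v} K] : Prop where
  vid_vcomp : ∀ {A B C D : K} {J : Hor A B} {f : A ⟶ C} {g : B ⟶ D} {L : Hor C D}
    (α : Cell J f g L), pre (vid J) α = α
  vcomp_vid : ∀ {A B C D : K} {J : Hor A B} {f : A ⟶ C} {g : B ⟶ D} {L : Hor C D}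
    (α : Cell J f g L), post α (vid L) = α
  vcomp_assoc : ∀ {A B C D E F X Y : K} {J : Hor A B} {L : Hor C D} {N : Hor E F} {P : Hor X Y}
    {f : A ⟶ C} {g : B ⟶ D} {h : C ⟶ E} {k : D ⟶ F} {p : E ⟶ X} {q : F ⟶ Y}
    (α : Cell J f g L) (β : Cell L h k N) (γ : Cell N p q P),
    recast rfl (Category.assoc f h p) (Category.assoc g k q) rfl (vcomp (vcomp α β) γ) =
      vcomp α (vcomp β γ)
  cunit_id : ∀ A : K, cunit (𝟙 A) = vid (hunit A)
  cunit_comp : ∀ {A B C : K} (f : A ⟶ B) (g : B ⟶ C), cunit (f ≫ g) = vcomp (cunit f) (cunit g)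
  ccomp_vid : ∀ {A B C : K} (J : Hor A B) (H : Hor B C),
    ccomp (vid J) (vid H) = vid (hcomp J H)
  interchange : ∀ {A B C A' B' C' A'' B'' C'' : K}
    {J : Hor A B} {H : Hor B C} {J' : Hor A' B'} {H' : Hor B' C'} {J'' : Hor A'' B''}
    {H'' : Hor B'' C''} {f : A ⟶ A'} {g : B ⟶ B'} {h : C ⟶ C'} {f' : A' ⟶ A''} {g' : B' ⟶ B''}
    {h' : C' ⟶ C''} (α : Cell J f g J') (β : Cell H g h H') (α' : Cell J' f' g' J'')
    (β' : Cell H' g' h' H''),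
    ccomp (vcomp α α') (vcomp β β') = vcomp (ccomp α β) (ccomp α' β')
  hassoc_hassocInv : ∀ {A B C D : K} (J : Hor A B) (H : Hor B C) (L : Hor C D),
    post (hassoc J H L) (hassocInv J H L) = vid (hcomp (hcomp J H) L)
  hassocInv_hassoc : ∀ {A B C D : K} (J : Hor A B) (H : Hor B C) (L : Hor C D),
    post (hassocInv J H L) (hassoc J H L) = vid (hcomp J (hcomp H L))
  leftUnitor_inv : ∀ {A B : K} (J : Hor A B),
    post (leftUnitor J) (leftUnitorInv J) = vid (hcomp (hunit A) J)
  inv_leftUnitor : ∀ {A B : K} (J : Hor A B), post (leftUnitorInv J) (leftUnitor J) = vid J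
  rightUnitor_inv : ∀ {A B : K} (J : Hor A B),
    post (rightUnitor J) (rightUnitorInv J) = vid (hcomp J (hunit B))
  inv_rightUnitor : ∀ {A B : K} (J : Hor A B), post (rightUnitorInv J) (rightUnitor J) = vid J
  assoc_naturality : ∀ {A B C D A' B' C' D' : K} {J : Hor A B} {H : Hor B C} {L : Hor C D}
    {J' : Hor A' B'} {H' : Hor B' C'} {L' : Hor C' D'} {f : A ⟶ A'} {g : B ⟶ B'} {h : C ⟶ C'}
    {k : D ⟶ D'} (α : Cell J f g J') (β : Cell H g h H') (γ : Cell L h k L'),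
    post (ccomp (ccomp α β) γ) (hassoc J' H' L') = pre (hassoc J H L) (ccomp α (ccomp β γ))
  leftUnitor_naturality : ∀ {A B C D : K} {J : Hor A B} {f : A ⟶ C} {g : B ⟶ D} {L : Hor C D}
    (α : Cell J f g L), post (ccomp (cunit f) α) (leftUnitor L) = pre (leftUnitor J) α
  rightUnitor_naturality : ∀ {A B C D : K} {J : Hor A B} {f : A ⟶ C} {g : B ⟶ D} {L : Hor C D}
    (α : Cell J f g L), post (ccomp α (cunit g)) (rightUnitor L) = pre (rightUnitor J) α
  pentagon : ∀ {A B C D E : K} (J : Hor A B) (H : Hor B C) (L : Hor C D) (N : Hor D E),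
    post (post (ccomp (hassoc J H L) (vid N)) (hassoc J (hcomp H L) N))
        (ccomp (vid J) (hassoc H L N)) =
      post (hassoc (hcomp J H) L N) (hassoc J H (hcomp L N))
  triangle : ∀ {A B C : K} (J : Hor A B) (H : Hor B C),
    post (hassoc J (hunit B) H) (ccomp (vid J) (leftUnitor H)) = ccomp (rightUnitor J) (vid H)

/-- (Pseudo) double categories. -/
class DoubleCategory (K : Type u) extends DoubleCategoryStruct.{z, w, v} K where
  laws : DoubleCategoryLaws K

namespace DoubleCategory

open DoubleCategoryStruct

section Basic

variable {K : Type u} [DoubleCategory.{z, w, v} K]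

/-- A cell `φ` is cartesian if every cell with the same horizontal target whose vertical boundary
factors through that of `φ` factors uniquely through `φ`. Then `J` is the restriction of `L`
along `f` and `g`. -/
def IsCartesian {A B C D : K} {J : Hor A B} {f : A ⟶ C} {g : B ⟶ D} {L : Hor C D}
    (φ : Cell J f g L) : Prop :=
  ∀ {X Y : K} (H : Hor X Y) (h : X ⟶ A) (k : Y ⟶ B) (χ : Cell H (h ≫ f) (k ≫ g) L),
    ∃! ψ : Cell H h k J, vcomp ψ φ = χ

variable (K) in
/-- An equipment is a double category with all restrictions. -/
def IsEquipment : Prop :=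
  ∀ {A B C D : K} (f : A ⟶ C) (g : B ⟶ D) (L : Hor C D),
    ∃ (J : Hor A B) (φ : Cell J f g L), IsCartesian φ

/-- `φ` exhibits `J` as the companion of `f`, that is, as the restriction of the horizontal unit
of `C` along `f` and the identity. -/
def IsCompanion {A C : K} (f : A ⟶ C) (J : Hor A C) (φ : Cell J f (𝟙 C) (hunit C)) : Prop :=
  IsCartesian φ

/-- Horizontal composite of cells whose horizontal targets are the unit of `M`, as a cell with
horizontal target the unit of `M`. -/
def hpaste {A B C M : K} {J : Hor A B} {H : Hor B C} {d : A ⟶ M} {l : B ⟶ M} {k : C ⟶ M}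
    (η : Cell J d l (hunit M)) (ψ : Cell H l k (hunit M)) : Cell (hcomp J H) d k (hunit M) :=
  post (ccomp η ψ) (leftUnitor (hunit M))

/-- Vertical cells `f ⇒ g`: cells with units as horizontal source and target. They are the
2-cells of the vertical 2-category. -/
abbrev VCell {A C : K} (f g : A ⟶ C) : Type z := Cell (hunit A) f g (hunit C)

/-- `η` defines `l` as the left Kan extension of `d` along `J`. -/
def IsLeftKan {A B M : K} {J : Hor A B} {d : A ⟶ M} {l : B ⟶ M}
    (η : Cell J d l (hunit M)) : Prop :=
  ∀ (k : B ⟶ M) (φ : Cell J d k (hunit M)),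
    ∃! ψ : VCell l k, φ = pre (rightUnitorInv J) (hpaste η ψ)

/-- `η` defines `l` as the pointwise left Kan extension of `d` along `J`. -/
def IsPointwiseLeftKan {A B M : K} {J : Hor A B} {d : A ⟶ M} {l : B ⟶ M}
    (η : Cell J d l (hunit M)) : Prop :=
  ∀ {C : K} (H : Hor B C) (k : C ⟶ M) (φ : Cell (hcomp J H) d k (hunit M)),
    ∃! ψ : Cell H l k (hunit M), φ = hpaste η ψ

namespace VCell

/-- Identity vertical cell. -/
def id {A C : K} (f : A ⟶ C) : VCell f f := cunit f

/-- Transport of a vertical cell along equalities of its source and target. -/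
def conv {A C : K} {f f' g g' : A ⟶ C} (hf : f = f') (hg : g = g') (φ : VCell f g) :
    VCell f' g' := recast rfl hf hg rfl φ

/-- The vertical cell given by an equality of vertical morphisms. -/
def ofEq {A C : K} {f g : A ⟶ C} (h : f = g) : VCell f g := conv rfl h (VCell.id f)

/-- Composition `f ⇒ g ⇒ h` in the hom-categories of the vertical 2-category. -/
def comp {A C : K} {f g h : A ⟶ C} (φ : VCell f g) (ψ : VCell g h) : VCell f h :=
  pre (leftUnitorInv (hunit A)) (hpaste φ ψ)

/-- Precomposition of a vertical cell with a vertical morphism. -/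
def whiskerLeft {A B C : K} (e : A ⟶ B) {f g : B ⟶ C} (φ : VCell f g) :
    VCell (e ≫ f) (e ≫ g) := vcomp (cunit e) φ

/-- Postcomposition of a vertical cell with a vertical morphism. -/
def whiskerRight {A B C : K} {f g : A ⟶ B} (φ : VCell f g) (h : B ⟶ C) :
    VCell (f ≫ h) (g ≫ h) := vcomp φ (cunit h)

/-- Invertibility in the hom-categories of the vertical 2-category. -/
def IsInvertible {A C : K} {f g : A ⟶ C} (φ : VCell f g) : Prop :=
  ∃ ψ : VCell g f, comp φ ψ = VCell.id f ∧ comp ψ φ = VCell.id g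

end VCell

end Basic

/-- The data of a lax double functor. -/
structure LaxDoubleFunctorStruct (K : Type u) [DoubleCategory.{z, w, v} K] (L : Type u')
    [DoubleCategory.{z', w', v'} L] extends K ⥤ L where
  /-- Action on horizontal morphisms. -/
  hor : ∀ {A B : K}, Hor A B → Hor (obj A) (obj B)
  /-- Action on cells. -/
  cell : ∀ {A B C D : K} {J : Hor A B} {f : A ⟶ C} {g : B ⟶ D} {P : Hor C D},
    Cell J f g P → Cell (hor J) (map f) (map g) (hor P)
  /-- Compositor cells. -/
  compositor : ∀ {A B C : K} (J : Hor A B) (H : Hor B C),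
    Cell (hcomp (hor J) (hor H)) (𝟙 (obj A)) (𝟙 (obj C)) (hor (hcomp J H))
  /-- Unitor cells. -/
  unitor : ∀ A : K, Cell (hunit (obj A)) (𝟙 (obj A)) (𝟙 (obj A)) (hor (hunit A))

namespace LaxDoubleFunctorStruct

variable {K : Type u} [DoubleCategory.{z, w, v} K] {L : Type u'} [DoubleCategory.{z', w', v'} L]

/-- The image of a horizontal cell, as a horizontal cell. -/
def gcell (F : LaxDoubleFunctorStruct K L) {A B : K} {J H : Hor A B}
    (σ : Cell J (𝟙 A) (𝟙 B) H) : Cell (F.hor J) (𝟙 (F.obj A)) (𝟙 (F.obj B)) (F.hor H) :=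
  recast rfl (F.map_id A) (F.map_id B) rfl (F.cell σ)

variable (K) in
/-- The identity double functor. -/
abbrev id : LaxDoubleFunctorStruct K K where
  toFunctor := 𝟭 K
  hor J := J
  cell α := α
  compositor J H := vid (hcomp J H)
  unitor A := vid (hunit A)

/-- The composite `G ∘ F` of double functors. -/
abbrev comp {M : Type*} [DoubleCategory M] (F : LaxDoubleFunctorStruct K L)
    (G : LaxDoubleFunctorStruct L M) : LaxDoubleFunctorStruct K M where
  toFunctor := F.toFunctor ⋙ G.toFunctor
  hor J := G.hor (F.hor J)
  cell α := G.cell (F.cell α)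
  compositor J H := post (G.compositor (F.hor J) (F.hor H)) (G.gcell (F.compositor J H))
  unitor A := post (G.unitor (F.obj A)) (G.gcell (F.unitor A))

end LaxDoubleFunctorStruct

/-- Lax double functors. -/
structure LaxDoubleFunctor (K : Type u) [DoubleCategory.{z, w, v} K] (L : Type u')
    [DoubleCategory.{z', w', v'} L] extends LaxDoubleFunctorStruct K L where
  cell_vid : ∀ {A B : K} (J : Hor A B), toLaxDoubleFunctorStruct.gcell (vid J) = vid (hor J)
  cell_vcomp : ∀ {A B C D E F : K} {J : Hor A B} {P : Hor C D} {N : Hor E F}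
    {f : A ⟶ C} {g : B ⟶ D} {h : C ⟶ E} {k : D ⟶ F} (α : Cell J f g P) (β : Cell P h k N),
    recast rfl (map_comp f h) (map_comp g k) rfl (cell (vcomp α β)) = vcomp (cell α) (cell β)
  compositor_naturality : ∀ {A B C A' B' C' : K} {J : Hor A B} {H : Hor B C} {J' : Hor A' B'}
    {H' : Hor B' C'} {f : A ⟶ A'} {g : B ⟶ B'} {h : C ⟶ C'} (α : Cell J f g J')
    (β : Cell H g h H'),
    post (ccomp (cell α) (cell β)) (compositor J' H') = pre (compositor J H) (cell (ccomp α β))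
  unitor_naturality : ∀ {A C : K} (f : A ⟶ C),
    post (cunit (map f)) (unitor C) = pre (unitor A) (cell (cunit f))
  associativity : ∀ {A B C D : K} (J : Hor A B) (H : Hor B C) (P : Hor C D),
    post (post (ccomp (compositor J H) (vid (hor P))) (compositor (hcomp J H) P))
        (toLaxDoubleFunctorStruct.gcell (hassoc J H P)) =
      post (post (hassoc (hor J) (hor H) (hor P)) (ccomp (vid (hor J)) (compositor H P)))
        (compositor J (hcomp H P))
  left_unitality : ∀ {A B : K} (J : Hor A B),
    post (post (ccomp (unitor A) (vid (hor J))) (compositor (hunit A) J))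
        (toLaxDoubleFunctorStruct.gcell (leftUnitor J)) = leftUnitor (hor J)
  right_unitality : ∀ {A B : K} (J : Hor A B),
    post (post (ccomp (vid (hor J)) (unitor B)) (compositor J (hunit B)))
        (toLaxDoubleFunctorStruct.gcell (rightUnitor J)) = rightUnitor (hor J)

/-- A double functor is normal if its unitor cells are identities. -/
structure LaxDoubleFunctorStruct.IsNormal {K : Type u} [DoubleCategory.{z, w, v} K] {L : Type u'}
    [DoubleCategory.{z', w', v'} L] (F : LaxDoubleFunctorStruct K L) : Prop where
  hor_hunit : ∀ A : K, F.hor (hunit A) = hunit (F.obj A)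
  unitor_eq : ∀ A : K,
    F.unitor A = recast rfl rfl rfl (hor_hunit A).symm (vid (hunit (F.obj A)))

/-- Double transformations `F ⇒ G`. -/
structure DoubleTransformation {K : Type u} [DoubleCategory.{z, w, v} K] {L : Type u'}
    [DoubleCategory.{z', w', v'} L] (F G : LaxDoubleFunctorStruct K L) where
  /-- Vertical components. -/
  app : ∀ A : K, F.obj A ⟶ G.obj A
  /-- Cell components. -/
  cell : ∀ {A B : K} (J : Hor A B), Cell (F.hor J) (app A) (app B) (G.hor J)
  naturality : ∀ {A C : K} (f : A ⟶ C), F.map f ≫ app C = app A ≫ G.map f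
  cell_naturality : ∀ {A B C D : K} {J : Hor A B} {f : A ⟶ C} {g : B ⟶ D} {P : Hor C D}
    (α : Cell J f g P),
    recast rfl (naturality f) (naturality g) rfl (vcomp (F.cell α) (cell P)) =
      vcomp (cell J) (G.cell α)
  cell_hcomp : ∀ {A B C : K} (J : Hor A B) (H : Hor B C),
    pre (F.compositor J H) (cell (hcomp J H)) = post (ccomp (cell J) (cell H)) (G.compositor J H)
  cell_hunit : ∀ A : K,
    pre (F.unitor A) (cell (hunit A)) = post (cunit (app A)) (G.unitor A)

/-- Normal lax double monads `(T, μ, ι)` on a double category. -/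
structure NormalLaxDoubleMonad (K : Type u) [DoubleCategory.{z, w, v} K] extends
    LaxDoubleFunctor K K where
  normal : toLaxDoubleFunctorStruct.IsNormal
  /-- The multiplication. -/
  μ : DoubleTransformation (toLaxDoubleFunctorStruct.comp toLaxDoubleFunctorStruct)
    toLaxDoubleFunctorStruct
  /-- The unit. -/
  ι : DoubleTransformation (LaxDoubleFunctorStruct.id K) toLaxDoubleFunctorStruct
  μ_μ : ∀ A : K, map (μ.app A) ≫ μ.app A = μ.app (obj A) ≫ μ.app A
  ι_μ : ∀ A : K, ι.app (obj A) ≫ μ.app A = 𝟙 (obj A)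
  map_ι_μ : ∀ A : K, map (ι.app A) ≫ μ.app A = 𝟙 (obj A)
  μ_μ_cell : ∀ {A B : K} (J : Hor A B),
    recast rfl (μ_μ A) (μ_μ B) rfl (vcomp (cell (μ.cell J)) (μ.cell J)) =
      vcomp (μ.cell (hor J)) (μ.cell J)
  ι_μ_cell : ∀ {A B : K} (J : Hor A B),
    recast rfl (ι_μ A) (ι_μ B) rfl (vcomp (ι.cell (hor J)) (μ.cell J)) = vid (hor J)
  map_ι_μ_cell : ∀ {A B : K} (J : Hor A B),
    recast rfl (map_ι_μ A) (map_ι_μ B) rfl (vcomp (cell (ι.cell J)) (μ.cell J)) = vid (hor J)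

namespace NormalLaxDoubleMonad

variable {K : Type u} [DoubleCategory.{z, w, v} K] (T : NormalLaxDoubleMonad K)

/-- The component `T²A ⟶ TA` of the multiplication. -/
abbrev mul (A : K) : T.obj (T.obj A) ⟶ T.obj A := T.μ.app A

/-- The component `A ⟶ TA` of the unit. -/
abbrev one (A : K) : A ⟶ T.obj A := T.ι.app A

theorem one_naturality {A C : K} (f : A ⟶ C) : f ≫ T.one C = T.one A ≫ T.map f :=
  T.ι.naturality f

theorem mul_naturality {A C : K} (f : A ⟶ C) :
    T.map (T.map f) ≫ T.mul C = T.mul A ≫ T.map f :=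
  T.μ.naturality f

/-- The image under `T` of a cell with horizontal target a unit; it is again such a cell, as `T`
is normal. -/
def mapToUnit {A B M : K} {J : Hor A B} {d : A ⟶ M} {l : B ⟶ M} (η : Cell J d l (hunit M)) :
    Cell (T.hor J) (T.map d) (T.map l) (hunit (T.obj M)) :=
  recast rfl rfl rfl (T.normal.hor_hunit M) (T.cell η)

/-- The action of the 2-monad that `T` restricts to on vertical cells. -/
def mapV {A C : K} {f g : A ⟶ C} (φ : VCell f g) : VCell (T.map f) (T.map g) :=
  recast (T.normal.hor_hunit A) rfl rfl rfl (T.mapToUnit φ)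

/-- Pseudo algebra structures `(m, m̄, m̂)` on an object `M`, for the 2-monad that `T` restricts to
on the vertical 2-category. -/
structure PseudoAlgebra (M : K) where
  /-- The action `m`. -/
  act : T.obj M ⟶ M
  /-- The associator `m ∘ Tm ⇒ m ∘ μ`. -/
  associator : VCell (T.map act ≫ act) (T.mul M ≫ act)
  /-- The unitor `id ⇒ m ∘ ι`. -/
  unitor : VCell (𝟙 M) (T.one M ≫ act)
  associator_invertible : VCell.IsInvertible associator
  unitor_invertible : VCell.IsInvertible unitor
  /-- The two composites `m ∘ Tm ∘ T²m ⇒ m ∘ μ ∘ μT` agree. -/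
  assoc_coherence :
    VCell.comp
        (VCell.conv
          (show T.map (T.map act ≫ act) ≫ act = T.map (T.map act) ≫ T.map act ≫ act by
            rw [T.map_comp, Category.assoc])
          (show T.map (T.mul M ≫ act) ≫ act = T.map (T.mul M) ≫ T.map act ≫ act by
            rw [T.map_comp, Category.assoc])
          (VCell.whiskerRight (T.mapV associator) act))
        (VCell.conv rfl
          (show T.map (T.mul M) ≫ T.mul M ≫ act = T.mul (T.obj M) ≫ T.mul M ≫ act by
            rw [← Category.assoc, ← Category.assoc, T.μ_μ])
          (VCell.whiskerLeft (T.map (T.mul M)) associator)) =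
      VCell.comp
        (VCell.conv rfl
          (show T.map (T.map act) ≫ T.mul M ≫ act = T.mul (T.obj M) ≫ T.map act ≫ act by
            rw [← Category.assoc, ← Category.assoc, T.mul_naturality])
          (VCell.whiskerLeft (T.map (T.map act)) associator))
        (VCell.whiskerLeft (T.mul (T.obj M)) associator)
  /-- The composite `m ⇒ m ∘ Tm ∘ Tι ⇒ m ∘ μ ∘ Tι = m` is the identity. -/
  unit_coherence :
    VCell.comp
        (VCell.conv
          (show T.map (𝟙 M) ≫ act = act by rw [T.map_id, Category.id_comp])
          (show T.map (T.one M ≫ act) ≫ act = T.map (T.one M) ≫ T.map act ≫ act by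
            rw [T.map_comp, Category.assoc])
          (VCell.whiskerRight (T.mapV unitor) act))
        (VCell.conv rfl
          (show T.map (T.one M) ≫ T.mul M ≫ act = act by
            rw [← Category.assoc, T.map_ι_μ, Category.id_comp])
          (VCell.whiskerLeft (T.map (T.one M)) associator)) =
      VCell.id act
  /-- The composite `m ⇒ m ∘ ι ∘ m = m ∘ Tm ∘ ιT ⇒ m ∘ μ ∘ ιT = m` is the identity. -/
  unit_coherence' :
    VCell.comp
        (VCell.conv
          (show act ≫ 𝟙 M = act from Category.comp_id act)
          (show act ≫ T.one M ≫ act = T.one (T.obj M) ≫ T.map act ≫ act by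
            rw [← Category.assoc, ← Category.assoc, T.one_naturality])
          (VCell.whiskerLeft act unitor))
        (VCell.conv rfl
          (show T.one (T.obj M) ≫ T.mul M ≫ act = act by
            rw [← Category.assoc, T.ι_μ, Category.id_comp])
          (VCell.whiskerLeft (T.one (T.obj M)) associator)) =
      VCell.id act

variable {T}

/-- An algebra is strict if its associator and unitor are identities. -/
def PseudoAlgebra.IsStrict {A : K} (X : T.PseudoAlgebra A) : Prop :=
  (∃ h : T.map X.act ≫ X.act = T.mul A ≫ X.act, X.associator = VCell.ofEq h) ∧
    ∃ h : 𝟙 A = T.one A ≫ X.act, X.unitor = VCell.ofEq h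

/-- `fbar : f ∘ a ⇒ c ∘ Tf` makes `f : A ⟶ C` into a colax `T`-morphism. -/
structure IsColaxMorphism {A C : K} (X : T.PseudoAlgebra A) (Y : T.PseudoAlgebra C) (f : A ⟶ C)
    (fbar : VCell (X.act ≫ f) (T.map f ≫ Y.act)) : Prop where
  /-- The composites `f ∘ a ∘ Ta ⇒ c ∘ Tf ∘ Ta ⇒ c ∘ Tc ∘ T²f ⇒ c ∘ μ ∘ T²f` and
  `f ∘ a ∘ Ta ⇒ f ∘ a ∘ μ ⇒ c ∘ Tf ∘ μ` agree. -/
  assoc :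
    VCell.comp
        (VCell.comp
          (VCell.whiskerLeft (T.map X.act) fbar)
          (VCell.conv
            (show T.map (X.act ≫ f) ≫ Y.act = T.map X.act ≫ T.map f ≫ Y.act by
              rw [T.map_comp, Category.assoc])
            (show T.map (T.map f ≫ Y.act) ≫ Y.act = T.map (T.map f) ≫ T.map Y.act ≫ Y.act by
              rw [T.map_comp, Category.assoc])
            (VCell.whiskerRight (T.mapV fbar) Y.act)))
        (VCell.conv rfl
          (show T.map (T.map f) ≫ T.mul C ≫ Y.act = T.mul A ≫ T.map f ≫ Y.act by
            rw [← Category.assoc, ← Category.assoc, T.mul_naturality])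
          (VCell.whiskerLeft (T.map (T.map f)) Y.associator)) =
      VCell.comp
        (VCell.conv
          (show (T.map X.act ≫ X.act) ≫ f = T.map X.act ≫ X.act ≫ f from Category.assoc _ _ _)
          (show (T.mul A ≫ X.act) ≫ f = T.mul A ≫ X.act ≫ f from Category.assoc _ _ _)
          (VCell.whiskerRight X.associator f))
        (VCell.whiskerLeft (T.mul A) fbar)
  /-- The composite `f ⇒ f ∘ a ∘ ι ⇒ c ∘ Tf ∘ ι = c ∘ ι ∘ f` is given by the unitor of `C`. -/
  unit :
    VCell.comp
        (VCell.conv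
          (show 𝟙 A ≫ f = f from Category.id_comp f)
          (show (T.one A ≫ X.act) ≫ f = T.one A ≫ X.act ≫ f from Category.assoc _ _ _)
          (VCell.whiskerRight X.unitor f))
        (VCell.conv rfl
          (show T.one A ≫ T.map f ≫ Y.act = f ≫ T.one C ≫ Y.act by
            rw [← Category.assoc, ← Category.assoc, T.one_naturality])
          (VCell.whiskerLeft (T.one A) fbar)) =
      VCell.conv (show f ≫ 𝟙 C = f from Category.comp_id f) rfl (VCell.whiskerLeft f Y.unitor)

variable (T) in
/-- The 2-monad that `T` restricts to on the vertical 2-category is colax-idempotent: every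
morphism between (strict) algebras is a colax morphism in a unique way. -/
def IsColaxIdempotent : Prop :=
  ∀ {A C : K} (X : T.PseudoAlgebra A) (Y : T.PseudoAlgebra C), X.IsStrict → Y.IsStrict →
    ∀ f : A ⟶ C, ∃! fbar : VCell (X.act ≫ f) (T.map f ≫ Y.act), IsColaxMorphism X Y f fbar

end NormalLaxDoubleMonad

end DoubleCategory

/-! The theorem reduces to the vertical 2-category $V(\mathcal K)$ and is there a matter of
adjunctions. Colax-idempotence, applied to free algebras, makes the action of every pseudo algebra
right adjoint to the unit: $\iota_A\dashv a$, with unit $\hat a$ (`PseudoAlgebra.exists_counit`).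
Hence cells $f\circ a\Rightarrow g$ correspond to cells $f\Rightarrow g\circ\iota_A$ by
transposition (`transpose_bijective`). The unit axiom of a colax structure on $f$ prescribes the
transpose of $\bar f$, and the associativity axiom follows from it
(`isColaxMorphism_iff_transpose`); so $\bar d$, $\bar l$ and also $\bar\jmath$ exist and are unique.

Transposition also turns a left Kan extension $\eta\colon d\Rightarrow l\circ j$ into a left Kan
extension $\kappa=(\bar\jmath\text{ whiskered by }l)\cdot(\eta\text{ whiskered by }a)$ of $d\circ a$
along $Tj$, with value $l\circ b$ (`isLeftKan_act`). Comparing transposes shows that $\bar d$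
followed by $m\circ T\eta$ equals $\kappa$ followed by $\bar l\circ Tj$. If $\bar d$ is invertible,
$\bar l$ is therefore the comparison from a Kan extension to $m\circ T\eta$, and it is invertible
exactly when $m\circ T\eta$ is a Kan extension too (`IsLeftKan.isInvertible_iff`).

The passage from $\mathcal K$ to $V(\mathcal K)$ uses companions: Kan extensions along $j_*$ are Kan
extensions along $j$ in $V(\mathcal K)$ (`IsCompanionPair.isLeftKan_iff`), and $T$, being normal,
sends companions to companions (`map_isCompanionPair`). Of pointwiseness only the instance at the
horizontal unit enters. -/

namespace DoubleCategory

open DoubleCategoryStruct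

/-! ### Calculus of cells without transport along boundary equalities -/

/-- Cells between four fixed objects with arbitrary boundary morphisms, together with a zero which
is the value of undefined composites. Equalities of boundary morphisms need no transport here. -/
inductive PCell {K : Type u} [DoubleCategoryStruct.{z, w, v} K] (A B C D : K) where
  | zero : PCell A B C D
  | of {J : Hor A B} {f : A ⟶ C} {g : B ⟶ D} {L : Hor C D} (α : Cell J f g L) : PCell A B C D

namespace PCell

section Struct

variable {K : Type u} [DoubleCategoryStruct.{z, w, v} K]

theorem of_injective {A B C D : K} {J : Hor A B} {f : A ⟶ C} {g : B ⟶ D} {L : Hor C D}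
    {α β : Cell J f g L} (h : of α = of β) : α = β := by
  injection h

@[simp]
theorem of_recast {A B C D : K} {J J' : Hor A B} {f f' : A ⟶ C} {g g' : B ⟶ D} {L L' : Hor C D}
    (hJ : J = J') (hf : f = f') (hg : g = g') (hL : L = L') (α : Cell J f g L) :
    of (recast hJ hf hg hL α) = of α := by
  subst hJ hf hg hL
  rfl

open Classical in
/-- Vertical composition. -/
noncomputable def vcomp {A B C D E F : K} : PCell A B C D → PCell C D E F → PCell A B E F
  | @of _ _ _ _ _ _ _ _ _ L α, @of _ _ _ _ _ _ L' _ _ _ β =>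
    if h : L = L' then of (DoubleCategoryStruct.vcomp α (recast h.symm rfl rfl rfl β)) else zero
  | _, _ => zero

open Classical in
/-- Horizontal composition. -/
noncomputable def hcomp {A B C D E F : K} : PCell A B D E → PCell B C E F → PCell A C D F
  | @of _ _ _ _ _ _ _ _ g _ α, @of _ _ _ _ _ _ _ g' _ _ β =>
    if h : g = g' then of (ccomp α (recast rfl h.symm rfl rfl β)) else zero
  | _, _ => zero

infixr:70 " ⋄ " => PCell.vcomp

@[simp]
theorem of_vcomp {A B C D E F : K} {J : Hor A B} {L : Hor C D} {N : Hor E F}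
    {f : A ⟶ C} {g : B ⟶ D} {h : C ⟶ E} {k : D ⟶ F} (α : Cell J f g L) (β : Cell L h k N) :
    of (DoubleCategoryStruct.vcomp α β) = of α ⋄ of β := by
  simp [vcomp, recast]

theorem of_ccomp {A B C A' B' C' : K} {J : Hor A B} {H : Hor B C} {J' : Hor A' B'}
    {H' : Hor B' C'} {f : A ⟶ A'} {g : B ⟶ B'} {h : C ⟶ C'} (α : Cell J f g J')
    (β : Cell H g h H') : of (ccomp α β) = hcomp (of α) (of β) := by
  simp [hcomp, recast]

@[simp]
theorem of_pre {A B C D : K} {J J' : Hor A B} {f : A ⟶ C} {g : B ⟶ D} {L : Hor C D}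
    (σ : Cell J' (𝟙 A) (𝟙 B) J) (α : Cell J f g L) : of (pre σ α) = of σ ⋄ of α := by
  simp [pre]

@[simp]
theorem of_post {A B C D : K} {J : Hor A B} {f : A ⟶ C} {g : B ⟶ D} {L L' : Hor C D}
    (α : Cell J f g L) (σ : Cell L (𝟙 C) (𝟙 D) L') : of (post α σ) = of α ⋄ of σ := by
  simp [post]

end Struct

variable {K : Type u} [DoubleCategory.{z, w, v} K]

-- No composability hypothesis is needed: each bracketing is nonzero exactly when both shared
-- horizontal boundaries match.
@[simp]
theorem vcomp_assoc {A B C D E F X Y : K} (x : PCell A B C D) (y : PCell C D E F)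
    (t : PCell E F X Y) : (x ⋄ y) ⋄ t = x ⋄ y ⋄ t := by
  rcases x with _ | @⟨J, f, g, L, α⟩
  · rfl
  rcases y with _ | @⟨L', h, k, N, β⟩
  · rfl
  rcases t with _ | @⟨N', p, q, P, γ⟩
  · by_cases h1 : L = L' <;> simp [vcomp, h1, -of_vcomp]
  by_cases h1 : L = L'
  · by_cases h2 : N = N'
    · subst h1 h2
      simp only [← of_vcomp, ← DoubleCategory.laws.vcomp_assoc, of_recast]
    · subst h1
      rw [← of_vcomp]
      simp [vcomp, h2, -of_vcomp]
  · by_cases h2 : N = N' <;> simp [vcomp, h1, h2, -of_vcomp]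

section

variable {A B C D : K} {J : Hor A B} {f : A ⟶ C} {g : B ⟶ D} {L : Hor C D} (α : Cell J f g L)

@[simp]
theorem vid_vcomp {J' : Hor A B} (h : J' = J) : of (vid J') ⋄ of α = of α := by
  subst h
  rw [← of_pre, DoubleCategory.laws.vid_vcomp]

@[simp]
theorem vcomp_vid {L' : Hor C D} (h : L = L') : of α ⋄ of (vid L') = of α := by
  subst h
  rw [← of_post, DoubleCategory.laws.vcomp_vid]

theorem leftUnitor_naturality :
    hcomp (of (cunit f)) (of α) ⋄ of (leftUnitor L) = of (leftUnitor J) ⋄ of α := by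
  simpa [of_ccomp] using congrArg of (DoubleCategory.laws.leftUnitor_naturality α)

theorem rightUnitor_naturality :
    hcomp (of α) (of (cunit g)) ⋄ of (rightUnitor L) = of (rightUnitor J) ⋄ of α := by
  simpa [of_ccomp] using congrArg of (DoubleCategory.laws.rightUnitor_naturality α)

end

theorem leftUnitor_inv {A B : K} (J : Hor A B) :
    of (leftUnitor J) ⋄ of (leftUnitorInv J) = of (vid (DoubleCategoryStruct.hcomp (hunit A) J)) := by
  rw [← of_post, DoubleCategory.laws.leftUnitor_inv]

theorem inv_leftUnitor {A B : K} (J : Hor A B) :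
    of (leftUnitorInv J) ⋄ of (leftUnitor J) = of (vid J) := by
  rw [← of_post, DoubleCategory.laws.inv_leftUnitor]

theorem rightUnitor_inv {A B : K} (J : Hor A B) :
    of (rightUnitor J) ⋄ of (rightUnitorInv J) = of (vid (DoubleCategoryStruct.hcomp J (hunit B))) := by
  rw [← of_post, DoubleCategory.laws.rightUnitor_inv]

theorem inv_rightUnitor {A B : K} (J : Hor A B) :
    of (rightUnitorInv J) ⋄ of (rightUnitor J) = of (vid J) := by
  rw [← of_post, DoubleCategory.laws.inv_rightUnitor]

theorem cunit_id (A : K) : of (cunit (𝟙 A)) = of (vid (hunit A)) := by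
  rw [DoubleCategory.laws.cunit_id, ]

theorem cunit_comp {A B C : K} (f : A ⟶ B) (g : B ⟶ C) :
    of (cunit (f ≫ g)) = of (cunit f) ⋄ of (cunit g) := by
  rw [DoubleCategory.laws.cunit_comp, of_vcomp]

section

variable {A B C D : K} {J : Hor A B} {f : A ⟶ C} {g : B ⟶ D} {L : Hor C D} (α : Cell J f g L)

theorem leftUnitorInv_naturality :
    of α ⋄ of (leftUnitorInv L) = of (leftUnitorInv J) ⋄ hcomp (of (cunit f)) (of α) := by
  have h := congrArg (fun x => of (leftUnitorInv J) ⋄ x ⋄ of (leftUnitorInv L))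
    (leftUnitor_naturality α)
  simp only [vcomp_assoc] at h
  rw [leftUnitor_inv, ← vcomp_assoc (of (leftUnitorInv J)) (of (leftUnitor J)), inv_leftUnitor,
    ← of_vcomp, vid_vcomp _ rfl, ← of_ccomp, vcomp_vid _ rfl, of_ccomp] at h
  rw [h, of_vcomp]

theorem rightUnitorInv_naturality :
    of α ⋄ of (rightUnitorInv L) = of (rightUnitorInv J) ⋄ hcomp (of α) (of (cunit g)) := by
  have h := congrArg (fun x => of (rightUnitorInv J) ⋄ x ⋄ of (rightUnitorInv L))
    (rightUnitor_naturality α)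
  simp only [vcomp_assoc] at h
  rw [rightUnitor_inv, ← vcomp_assoc (of (rightUnitorInv J)) (of (rightUnitor J)), inv_rightUnitor,
    ← of_vcomp, vid_vcomp _ rfl, ← of_ccomp, vcomp_vid _ rfl, of_ccomp] at h
  rw [h, of_vcomp]

end

/-- Unlike associativity, this needs matching boundaries: with `g₁ ≠ g₂` the composites `g₁ ≫ g₁'`
and `g₂ ≫ g₂'` may still agree, and then the left side is defined while the right side is zero. -/
theorem interchange {A B C A' B' C' A'' B'' C'' : K}
    {J : Hor A B} {H : Hor B C} {J₁ J₂ : Hor A' B'} {H₁ H₂ : Hor B' C'} {J'' : Hor A'' B''}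
    {H'' : Hor B'' C''} {f : A ⟶ A'} {g₁ g₂ : B ⟶ B'} {h : C ⟶ C'} {f' : A' ⟶ A''}
    {g₁' g₂' : B' ⟶ B''} {h' : C' ⟶ C''} (α : Cell J f g₁ J₁) (β : Cell H g₂ h H₁)
    (α' : Cell J₂ f' g₁' J'') (β' : Cell H₂ g₂' h' H'') (hJ : J₁ = J₂) (hH : H₁ = H₂)
    (hg : g₁ = g₂) (hg' : g₁' = g₂') :
    hcomp (of α ⋄ of α') (of β ⋄ of β') = hcomp (of α) (of β) ⋄ hcomp (of α') (of β') := by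
  subst hJ hH hg hg'
  simp only [← of_vcomp, ← of_ccomp, DoubleCategory.laws.interchange]

theorem hassoc_naturality {A B C D A' B' C' D' : K} {J : Hor A B} {H : Hor B C} {L : Hor C D}
    {J' : Hor A' B'} {H' : Hor B' C'} {L' : Hor C' D'} {f : A ⟶ A'} {g : B ⟶ B'} {h : C ⟶ C'}
    {k : D ⟶ D'} (α : Cell J f g J') (β : Cell H g h H') (γ : Cell L h k L') :
    hcomp (hcomp (of α) (of β)) (of γ) ⋄ of (hassoc J' H' L') =
      of (hassoc J H L) ⋄ hcomp (of α) (hcomp (of β) (of γ)) := by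
  simpa [of_ccomp] using congrArg of (DoubleCategory.laws.assoc_naturality α β γ)

end PCell

/-! ### The two unitors of a horizontal unit agree -/

section Unitors

variable {K : Type u} [DoubleCategory.{z, w, v} K]

open PCell

/-- Horizontal endomorphisms of an object and horizontal cells between them. -/
abbrev horEndCategory (A : K) : Category.{z} (Hor A A) where
  Hom J L := Cell J (𝟙 A) (𝟙 A) L
  id J := vid J
  comp α β := post α β
  id_comp α := of_injective (by simp)
  comp_id α := of_injective (by simp)
  assoc α β γ := of_injective (by simp)

section

variable {A B C : K} {J J' J'' P : Hor A B} {H H' H'' : Hor B C}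

theorem pre_eq_post (α : Cell J (𝟙 A) (𝟙 B) J') (β : Cell J' (𝟙 A) (𝟙 B) J'') :
    pre α β = post α β :=
  of_injective (by simp)

theorem post_assoc (α : Cell J (𝟙 A) (𝟙 B) J') (β : Cell J' (𝟙 A) (𝟙 B) J'')
    (γ : Cell J'' (𝟙 A) (𝟙 B) P) : post (post α β) γ = post α (post β γ) :=
  of_injective (by simp)

theorem post_ccomp_ccomp (α : Cell J (𝟙 A) (𝟙 B) J') (β : Cell H (𝟙 B) (𝟙 C) H')
    (α' : Cell J' (𝟙 A) (𝟙 B) J'') (β' : Cell H' (𝟙 B) (𝟙 C) H'') :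
    post (ccomp α β) (ccomp α' β') = ccomp (post α α') (post β β') := by
  apply of_injective
  rw [of_post, of_ccomp, of_ccomp, ← interchange α β α' β' rfl rfl rfl rfl, of_ccomp, of_post,
    of_post]

theorem post_leftUnitor (α : Cell J (𝟙 A) (𝟙 B) J') :
    post (ccomp (vid (hunit A)) α) (leftUnitor J') = post (leftUnitor J) α :=
  of_injective (by simpa [of_ccomp, cunit_id] using leftUnitor_naturality α)

theorem post_rightUnitor (α : Cell J (𝟙 A) (𝟙 B) J') :
    post (ccomp α (vid (hunit B))) (rightUnitor J') = post (rightUnitor J) α :=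
  of_injective (by simpa [of_ccomp, cunit_id] using rightUnitor_naturality α)

end

/-- The monoidal structure on horizontal endomorphisms of an object. -/
abbrev horEndMonoidalCategoryStruct (A : K) :
    letI := horEndCategory A
    MonoidalCategoryStruct (Hor A A) :=
  letI := horEndCategory A
  { tensorObj := DoubleCategoryStruct.hcomp
    tensorHom := fun α β => ccomp α β
    whiskerLeft := fun J _ _ β => ccomp (vid J) β
    whiskerRight := fun α J => ccomp α (vid J)
    tensorUnit := hunit A
    associator := fun J H L => ⟨hassoc J H L, hassocInv J H L,
      DoubleCategory.laws.hassoc_hassocInv J H L, DoubleCategory.laws.hassocInv_hassoc J H L⟩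
    leftUnitor := fun J => ⟨leftUnitor J, leftUnitorInv J,
      DoubleCategory.laws.leftUnitor_inv J, DoubleCategory.laws.inv_leftUnitor J⟩
    rightUnitor := fun J => ⟨rightUnitor J, rightUnitorInv J,
      DoubleCategory.laws.rightUnitor_inv J, DoubleCategory.laws.inv_rightUnitor J⟩ }

/-- The monoidal category of horizontal endomorphisms of an object. -/
abbrev horEndMonoidalCategory (A : K) :
    letI := horEndCategory A
    MonoidalCategory (Hor A A) :=
  letI := horEndCategory A
  letI := horEndMonoidalCategoryStruct A
  MonoidalCategory.ofTensorHom
    (id_tensorHom := fun _ _ _ _ => rfl)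
    (tensorHom_id := fun _ _ => rfl)
    (id_tensorHom_id := fun J H => DoubleCategory.laws.ccomp_vid J H)
    (tensorHom_comp_tensorHom := fun α β α' β' => post_ccomp_ccomp α β α' β')
    (associator_naturality := fun α β γ => DoubleCategory.laws.assoc_naturality α β γ |>.trans
      (pre_eq_post _ _))
    (leftUnitor_naturality := fun α => post_leftUnitor α)
    (rightUnitor_naturality := fun α => post_rightUnitor α)
    (pentagon := fun J H L N => (post_assoc _ _ _).symm.trans (DoubleCategory.laws.pentagon J H L N))
    (triangle := fun J H => DoubleCategory.laws.triangle J H)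

/-- This coherence is not among the axioms of a double category. It is Kelly's theorem for the
monoidal category of horizontal endomorphisms of `A`, and it allows naturality of either unitor to
be used on vertical cells. -/
theorem leftUnitor_hunit (A : K) : leftUnitor (hunit A) = rightUnitor (hunit A) :=
  letI := horEndCategory A
  letI := horEndMonoidalCategory A
  MonoidalCategory.unitors_equal (C := Hor A A)

end Unitors

end DoubleCategory

/-! ### The vertical 2-category -/

namespace DoubleCategory

open DoubleCategoryStruct

namespace VCell

open PCell

variable {K : Type u} [DoubleCategory.{z, w, v} K]

theorem of_comp {A C : K} {f g h : A ⟶ C} (φ : VCell f g) (ψ : VCell g h) :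
    of (comp φ ψ) =
      of (leftUnitorInv (hunit A)) ⋄ hcomp (of φ) (of ψ) ⋄ of (leftUnitor (hunit C)) := by
  simp [comp, hpaste, of_ccomp]

@[simp]
theorem of_conv {A C : K} {f f' g g' : A ⟶ C} (hf : f = f') (hg : g = g') (φ : VCell f g) :
    of (conv hf hg φ) = of φ :=
  of_recast _ _ _ _ _

theorem of_id {A C : K} (f : A ⟶ C) : of (VCell.id f) = of (cunit f) := rfl

theorem of_whiskerLeft {A B C : K} (e : A ⟶ B) {f g : B ⟶ C} (φ : VCell f g) :
    of (whiskerLeft e φ) = of (cunit e) ⋄ of φ :=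
  of_vcomp _ _

theorem of_whiskerRight {A B C : K} {f g : A ⟶ B} (φ : VCell f g) (h : B ⟶ C) :
    of (whiskerRight φ h) = of φ ⋄ of (cunit h) :=
  of_vcomp _ _

theorem hcomp_post {A B C A' B' C' : K} {J : Hor A B} {H : Hor B C} {J₁ J₂ : Hor A' B'}
    {H₁ H₂ : Hor B' C'} {f : A ⟶ A'} {g : B ⟶ B'} {h : C ⟶ C'} (α : Cell J f g J₁)
    (β : Cell H g h H₁) (σ : Cell J₁ (𝟙 A') (𝟙 B') J₂) (τ : Cell H₁ (𝟙 B') (𝟙 C') H₂) :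
    hcomp (of (post α σ)) (of (post β τ)) = hcomp (of α) (of β) ⋄ hcomp (of σ) (of τ) := by
  rw [of_post, of_post, interchange _ _ _ _ rfl rfl rfl rfl]

theorem hcomp_pre {A B C A' B' C' : K} {J J' : Hor A B} {H H' : Hor B C} {J₁ : Hor A' B'}
    {H₁ : Hor B' C'} {f : A ⟶ A'} {g : B ⟶ B'} {h : C ⟶ C'} (α : Cell J f g J₁)
    (β : Cell H g h H₁) (σ : Cell J' (𝟙 A) (𝟙 B) J) (τ : Cell H' (𝟙 B) (𝟙 C) H) :
    hcomp (of (pre σ α)) (of (pre τ β)) = hcomp (of σ) (of τ) ⋄ hcomp (of α) (of β) := by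
  rw [of_pre, of_pre, interchange _ _ _ _ rfl rfl rfl rfl]

theorem leftUnitorInv_hunit (A : K) : leftUnitorInv (hunit A) = rightUnitorInv (hunit A) := by
  apply of_injective
  rw [← vid_vcomp (rightUnitorInv (hunit A)) rfl, ← inv_leftUnitor, leftUnitor_hunit, vcomp_assoc,
    rightUnitor_inv, vcomp_vid _ rfl]

theorem inv_unitor_vcomp {A B C D : K} (t : PCell A B C D) {J : Hor A B} {f : A ⟶ C} {g : B ⟶ D}
    {L : Hor C D} (α : Cell J f g L) (ht : t = of α) :
    of (leftUnitorInv J) ⋄ of (leftUnitor J) ⋄ t = t := by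
  rw [← vcomp_assoc, inv_leftUnitor, ht, vid_vcomp _ rfl]

theorem id_comp {A C : K} {f g : A ⟶ C} (φ : VCell f g) : comp (VCell.id f) φ = φ := by
  apply of_injective
  rw [of_comp, of_id, leftUnitor_naturality, inv_unitor_vcomp _ φ rfl]

theorem comp_id {A C : K} {f g : A ⟶ C} (φ : VCell f g) : comp φ (VCell.id g) = φ := by
  apply of_injective
  rw [of_comp, of_id, leftUnitor_hunit, rightUnitor_naturality, ← leftUnitor_hunit,
    inv_unitor_vcomp _ φ rfl]

theorem comp_assoc {A C : K} {f g h k : A ⟶ C} (φ : VCell f g) (ψ : VCell g h) (χ : VCell h k) :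
    comp (comp φ ψ) χ = comp φ (comp ψ χ) := by
  -- The triangle axiom at the unit, with the right unitor replaced by the left one; `tri'` is its
  -- inverse form. Together they absorb the associator.
  have tri (X : K) : of (hassoc (hunit X) (hunit X) (hunit X)) ⋄
      hcomp (of (vid (hunit X))) (of (leftUnitor (hunit X))) =
      hcomp (of (leftUnitor (hunit X))) (of (vid (hunit X))) := by
    rw [leftUnitor_hunit]
    simpa [of_ccomp, leftUnitor_hunit] using
      congrArg of (DoubleCategory.laws.triangle (hunit X) (hunit X))
  have tri' : hcomp (of (leftUnitorInv (hunit A))) (of (vid (hunit A))) ⋄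
      of (hassoc (hunit A) (hunit A) (hunit A)) =
      hcomp (of (vid (hunit A))) (of (leftUnitorInv (hunit A))) := by
    have h1 : hcomp (of (leftUnitorInv (hunit A))) (of (vid (hunit A))) ⋄
        hcomp (of (leftUnitor (hunit A))) (of (vid (hunit A))) =
        of (vid (DoubleCategoryStruct.hcomp (hunit A) (hunit A))) := by
      rw [← interchange _ _ _ _ rfl rfl rfl rfl, inv_leftUnitor, vid_vcomp _ rfl, ← of_ccomp,
        DoubleCategory.laws.ccomp_vid]
    have h2 : hcomp (of (vid (hunit A))) (of (leftUnitor (hunit A))) ⋄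
        hcomp (of (vid (hunit A))) (of (leftUnitorInv (hunit A))) =
        of (vid (DoubleCategoryStruct.hcomp (hunit A)
          (DoubleCategoryStruct.hcomp (hunit A) (hunit A)))) := by
      rw [← interchange _ _ _ _ rfl rfl rfl rfl, leftUnitor_inv, vid_vcomp _ rfl, ← of_ccomp,
        DoubleCategory.laws.ccomp_vid]
    have h3 := congrArg (fun x => (hcomp (of (leftUnitorInv (hunit A))) (of (vid (hunit A))) ⋄ x) ⋄
      hcomp (of (vid (hunit A))) (of (leftUnitorInv (hunit A)))) (tri A)
    simp only [h1, vcomp_assoc] at h3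
    rw [h2, vcomp_vid _ rfl, ← of_ccomp (vid (hunit A)), vid_vcomp _ rfl] at h3
    rw [h3, of_ccomp]
  apply of_injective
  have hl : hcomp (of (comp φ ψ)) (of χ) = hcomp (of (leftUnitorInv (hunit A))) (of (vid (hunit A))) ⋄
      hcomp (hcomp (of φ) (of ψ)) (of χ) ⋄
      hcomp (of (leftUnitor (hunit C))) (of (vid (hunit C))) := by
    rw [← of_ccomp φ ψ, ← hcomp_post, ← hcomp_pre, DoubleCategory.laws.vcomp_vid,
      DoubleCategory.laws.vid_vcomp]
    rfl
  have hr : hcomp (of φ) (of (comp ψ χ)) = hcomp (of (vid (hunit A))) (of (leftUnitorInv (hunit A))) ⋄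
      hcomp (of φ) (hcomp (of ψ) (of χ)) ⋄
      hcomp (of (vid (hunit C))) (of (leftUnitor (hunit C))) := by
    rw [← of_ccomp ψ χ, ← hcomp_post, ← hcomp_pre, DoubleCategory.laws.vcomp_vid,
      DoubleCategory.laws.vid_vcomp]
    rfl
  rw [of_comp (comp φ ψ), of_comp φ (comp ψ χ), hl, hr, ← tri C, ← tri']
  simp only [vcomp_assoc]
  rw [← vcomp_assoc (hcomp (hcomp (of φ) (of ψ)) (of χ)), hassoc_naturality]
  simp only [vcomp_assoc]

/-- The vertical composite in the double category is the Godement product in the vertical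
2-category; its two expressions by whiskering give the exchange law. -/
theorem vcomp_eq_comp {A B C : K} {f f' : A ⟶ B} {g g' : B ⟶ C} (φ : VCell f f')
    (ψ : VCell g g') : of (comp (whiskerLeft f ψ) (whiskerRight φ g')) = of φ ⋄ of ψ := by
  rw [of_comp, of_whiskerLeft, of_whiskerRight, interchange _ _ _ _ rfl rfl rfl rfl, vcomp_assoc,
    leftUnitor_hunit, rightUnitor_naturality, ← leftUnitor_hunit,
    ← vcomp_assoc (hcomp _ _), leftUnitor_naturality, vcomp_assoc,
    ← vcomp_assoc (of (leftUnitorInv _)), inv_leftUnitor, ← of_vcomp, vid_vcomp _ rfl]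

theorem vcomp_eq_comp' {A B C : K} {f f' : A ⟶ B} {g g' : B ⟶ C} (φ : VCell f f')
    (ψ : VCell g g') : of (comp (whiskerRight φ g) (whiskerLeft f' ψ)) = of φ ⋄ of ψ := by
  rw [of_comp, of_whiskerLeft, of_whiskerRight, interchange _ _ _ _ rfl rfl rfl rfl, vcomp_assoc,
    leftUnitor_naturality, leftUnitor_hunit, ← vcomp_assoc (hcomp _ _), rightUnitor_naturality,
    vcomp_assoc, ← leftUnitor_hunit,
    ← vcomp_assoc (of (leftUnitorInv _)), inv_leftUnitor, ← of_vcomp, vid_vcomp _ rfl]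

theorem exchange {A B C : K} {f f' : A ⟶ B} {g g' : B ⟶ C} (φ : VCell f f') (ψ : VCell g g') :
    comp (whiskerLeft f ψ) (whiskerRight φ g') = comp (whiskerRight φ g) (whiskerLeft f' ψ) := by
  apply of_injective
  rw [vcomp_eq_comp, vcomp_eq_comp']

theorem whiskerLeft_comp {A B C : K} (e : A ⟶ B) {f g h : B ⟶ C} (φ : VCell f g) (ψ : VCell g h) :
    whiskerLeft e (comp φ ψ) = comp (whiskerLeft e φ) (whiskerLeft e ψ) := by
  apply of_injective
  rw [of_whiskerLeft, of_comp, of_comp, of_whiskerLeft, of_whiskerLeft,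
    interchange _ _ _ _ rfl rfl rfl rfl, ← vcomp_assoc, leftUnitorInv_naturality]
  simp only [vcomp_assoc]

theorem comp_whiskerRight {A B C : K} {f g h : A ⟶ B} (φ : VCell f g) (ψ : VCell g h)
    (e : B ⟶ C) :
    whiskerRight (comp φ ψ) e = comp (whiskerRight φ e) (whiskerRight ψ e) := by
  apply of_injective
  rw [of_whiskerRight, of_comp, of_comp, of_whiskerRight, of_whiskerRight,
    interchange _ _ _ _ rfl rfl rfl rfl]
  simp only [vcomp_assoc]
  rw [← leftUnitor_naturality]

theorem whiskerLeft_id {A B C : K} (e : A ⟶ B) (f : B ⟶ C) :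
    whiskerLeft e (VCell.id f) = VCell.id (e ≫ f) :=
  (DoubleCategory.laws.cunit_comp e f).symm

theorem id_whiskerRight {A B C : K} (f : A ⟶ B) (e : B ⟶ C) :
    whiskerRight (VCell.id f) e = VCell.id (f ≫ e) :=
  (DoubleCategory.laws.cunit_comp f e).symm

end VCell

/-! ### The 2-functor that `T` induces on vertical cells -/

namespace NormalLaxDoubleMonad

open PCell

variable {K : Type u} [DoubleCategory.{z, w, v} K] (T : NormalLaxDoubleMonad K)

theorem of_mapV {A C : K} {f g : A ⟶ C} (φ : VCell f g) : of (T.mapV φ) = of (T.cell φ) := by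
  simp [mapV, mapToUnit]

theorem of_unitor (A : K) : of (T.unitor A) = of (vid (hunit (T.obj A))) := by
  rw [T.normal.unitor_eq, of_recast]

theorem of_vid_hor (A : K) : of (vid (T.hor (hunit A))) = of (vid (hunit (T.obj A))) := by
  rw [T.normal.hor_hunit]

theorem of_cell_vid {A B : K} (J : Hor A B) : of (T.cell (vid J)) = of (vid (T.hor J)) := by
  rw [← T.cell_vid, LaxDoubleFunctorStruct.gcell, of_recast]

theorem of_gcell {A B : K} {J H : Hor A B} (σ : Cell J (𝟙 A) (𝟙 B) H) :
    of (T.gcell σ) = of (T.cell σ) := by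
  rw [LaxDoubleFunctorStruct.gcell, of_recast]

theorem of_cell_vcomp {A B C D E F : K} {J : Hor A B} {P : Hor C D} {N : Hor E F}
    {f : A ⟶ C} {g : B ⟶ D} {h : C ⟶ E} {k : D ⟶ F} (α : Cell J f g P) (β : Cell P h k N) :
    of (T.cell (vcomp α β)) = of (T.cell α) ⋄ of (T.cell β) := by
  rw [← of_vcomp, ← T.cell_vcomp, of_recast]

theorem of_cell_recast {A B C D : K} {J J' : Hor A B} {f f' : A ⟶ C} {g g' : B ⟶ D}
    {L L' : Hor C D} (hJ : J = J') (hf : f = f') (hg : g = g') (hL : L = L') (α : Cell J f g L) :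
    of (T.cell (recast hJ hf hg hL α)) = of (T.cell α) := by
  subst hJ hf hg hL
  rfl

/-- Naturality of the unitor cells, which are identities by normality. -/
theorem of_cell_cunit {A C : K} (f : A ⟶ C) : of (T.cell (cunit f)) = of (cunit (T.map f)) := by
  have h := congrArg of (T.unitor_naturality f)
  rw [of_post, of_pre, of_unitor, of_unitor, vcomp_vid _ rfl,
    vid_vcomp _ (T.normal.hor_hunit A).symm] at h
  exact h.symm

theorem compositor_naturality' {A B C A' B' C' : K} {J : Hor A B} {H : Hor B C} {J' : Hor A' B'}
    {H' : Hor B' C'} {f : A ⟶ A'} {g : B ⟶ B'} {h : C ⟶ C'} (α : Cell J f g J')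
    (β : Cell H g h H') :
    hcomp (of (T.cell α)) (of (T.cell β)) ⋄ of (T.compositor J' H') =
      of (T.compositor J H) ⋄ of (T.cell (ccomp α β)) := by
  have h := congrArg of (T.compositor_naturality α β)
  rwa [of_post, of_pre, of_ccomp] at h

theorem ccomp_unitor_left {A B : K} (J : Hor A B) :
    of (ccomp (T.unitor A) (vid (T.hor J))) =
      of (vid (DoubleCategoryStruct.hcomp (hunit (T.obj A)) (T.hor J))) := by
  rw [of_ccomp, of_unitor, ← of_ccomp, DoubleCategory.laws.ccomp_vid]

theorem ccomp_unitor_right {A B : K} (J : Hor A B) :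
    of (ccomp (vid (T.hor J)) (T.unitor B)) =
      of (vid (DoubleCategoryStruct.hcomp (T.hor J) (hunit (T.obj B)))) := by
  rw [of_ccomp, of_unitor, ← of_ccomp, DoubleCategory.laws.ccomp_vid]

theorem compositor_leftUnitor {A B : K} (J : Hor A B) :
    of (T.compositor (hunit A) J) ⋄ of (T.cell (leftUnitor J)) = of (leftUnitor (T.hor J)) := by
  rw [← T.left_unitality J, of_post, of_post, ccomp_unitor_left, of_gcell,
    vid_vcomp _ (by rw [T.normal.hor_hunit])]

theorem compositor_rightUnitor {A B : K} (J : Hor A B) :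
    of (T.compositor J (hunit B)) ⋄ of (T.cell (rightUnitor J)) = of (rightUnitor (T.hor J)) := by
  rw [← T.right_unitality J, of_post, of_post, ccomp_unitor_right, of_gcell,
    vid_vcomp _ (by rw [T.normal.hor_hunit])]

theorem leftUnitorInv_compositor {A B : K} (J : Hor A B) :
    of (leftUnitorInv (T.hor J)) ⋄ of (T.compositor (hunit A) J) =
      of (T.cell (leftUnitorInv J)) := by
  have h : of (T.cell (leftUnitor J)) ⋄ of (T.cell (leftUnitorInv J)) =
      of (vid (T.hor (DoubleCategoryStruct.hcomp (hunit A) J))) := by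
    rw [← of_cell_vcomp, ← of_cell_vid, ← DoubleCategory.laws.leftUnitor_inv, post, of_cell_recast]
  rw [← vcomp_vid (T.compositor (hunit A) J) rfl, ← h, ← vcomp_assoc (of (T.compositor _ _)),
    compositor_leftUnitor, ← vcomp_assoc, inv_leftUnitor, vid_vcomp _ rfl]

theorem of_leftUnitor_hor_hunit (A : K) :
    of (leftUnitor (T.hor (hunit A))) = of (leftUnitor (hunit (T.obj A))) := by
  rw [T.normal.hor_hunit]

theorem of_leftUnitorInv_hor_hunit (A : K) :
    of (leftUnitorInv (T.hor (hunit A))) = of (leftUnitorInv (hunit (T.obj A))) := by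
  rw [T.normal.hor_hunit]

theorem mapV_comp {A C : K} {f g h : A ⟶ C} (φ : VCell f g) (ψ : VCell g h) :
    T.mapV (VCell.comp φ ψ) = VCell.comp (T.mapV φ) (T.mapV ψ) := by
  apply of_injective
  rw [of_mapV, VCell.of_comp, VCell.comp, pre, of_cell_recast, of_cell_vcomp, hpaste, post,
    of_cell_recast, of_cell_vcomp, ← leftUnitorInv_compositor, vcomp_assoc,
    ← vcomp_assoc (of (T.compositor _ _)), ← compositor_naturality', vcomp_assoc,
    compositor_leftUnitor, of_mapV, of_mapV, of_leftUnitor_hor_hunit, of_leftUnitorInv_hor_hunit]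

theorem mapV_id {A C : K} (f : A ⟶ C) : T.mapV (VCell.id f) = VCell.id (T.map f) := by
  apply of_injective
  rw [of_mapV, VCell.id, of_cell_cunit, VCell.id]

theorem of_mapV_whiskerLeft {A B C : K} (e : A ⟶ B) {f g : B ⟶ C} (φ : VCell f g) :
    of (T.mapV (VCell.whiskerLeft e φ)) = of (VCell.whiskerLeft (T.map e) (T.mapV φ)) := by
  rw [of_mapV, VCell.whiskerLeft, of_cell_vcomp, of_cell_cunit, VCell.of_whiskerLeft, of_mapV]

theorem of_mapV_whiskerRight {A B C : K} {f g : A ⟶ B} (φ : VCell f g) (e : B ⟶ C) :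
    of (T.mapV (VCell.whiskerRight φ e)) = of (VCell.whiskerRight (T.mapV φ) (T.map e)) := by
  rw [of_mapV, VCell.whiskerRight, of_cell_vcomp, of_cell_cunit, VCell.of_whiskerRight, of_mapV]

/-- The component of `T.ι` at a horizontal unit is a unit cell, so naturality of `T.ι` in cells
specializes to 2-naturality. -/
theorem of_whiskerRight_one {A C : K} {f g : A ⟶ C} (φ : VCell f g) :
    of (VCell.whiskerRight φ (T.one C)) = of (VCell.whiskerLeft (T.one A) (T.mapV φ)) := by
  have hι (A : K) : of (T.ι.cell (hunit A)) = of (cunit (T.one A)) := by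
    have h := congrArg of (T.ι.cell_hunit A)
    rw [of_pre, of_post, of_unitor] at h
    change of (vid _) ⋄ _ = _ at h
    rwa [vid_vcomp _ rfl, vcomp_vid _ rfl] at h
  have h := congrArg of (T.ι.cell_naturality φ)
  rw [of_recast, of_vcomp, of_vcomp, hι, hι] at h
  rw [VCell.of_whiskerLeft, VCell.of_whiskerRight, of_mapV]
  exact h

end NormalLaxDoubleMonad

end DoubleCategory

/-! ### Calculus of vertical cells as a semigroup with zero -/

namespace DoubleCategory

open DoubleCategoryStruct

/-- Vertical cells between two fixed objects with arbitrary source and target, together with a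
zero which is the value of undefined composites. -/
inductive TwoCell {K : Type u} [DoubleCategory.{z, w, v} K] (A C : K) where
  | zero : TwoCell A C
  | of {f g : A ⟶ C} (φ : VCell f g) : TwoCell A C

namespace TwoCell

variable {K : Type u} [DoubleCategory.{z, w, v} K]

theorem of_injective {A C : K} {f g : A ⟶ C} {φ ψ : VCell f g} (h : of φ = of ψ) : φ = ψ := by
  injection h

theorem of_inj {A C : K} {f g : A ⟶ C} {φ ψ : VCell f g} : of φ = of ψ ↔ φ = ψ :=
  ⟨of_injective, congrArg of⟩

theorem of_congr {A C : K} {f g f' g' : A ⟶ C} {φ : VCell f g} {ψ : VCell f' g'} (hf : f = f')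
    (hg : g = g') (h : PCell.of φ = PCell.of ψ) : of φ = of ψ := by
  subst hf hg
  rw [PCell.of_injective h]

@[simp]
theorem of_conv {A C : K} {f f' g g' : A ⟶ C} (hf : f = f') (hg : g = g') (φ : VCell f g) :
    of (VCell.conv hf hg φ) = of φ := by
  subst hf hg
  rfl

/-- The source. -/
def src {A C : K} : TwoCell A C → Option (A ⟶ C)
  | zero => none
  | @of _ _ _ _ f _ _ => some f

/-- The target. -/
def tgt {A C : K} : TwoCell A C → Option (A ⟶ C)
  | zero => none
  | @of _ _ _ _ _ g _ => some g

/-- Whiskering on the source side. -/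
def wl {A B C : K} (e : A ⟶ B) : TwoCell B C → TwoCell A C
  | zero => zero
  | of φ => of (VCell.whiskerLeft e φ)

/-- Whiskering on the target side. -/
def wr {A B C : K} (x : TwoCell A B) (h : B ⟶ C) : TwoCell A C :=
  match x with
  | zero => zero
  | of φ => of (VCell.whiskerRight φ h)

/-- Identities. -/
def idt {A C : K} (f : A ⟶ C) : TwoCell A C := of (VCell.id f)

-- The product is composition in a hom-category, in diagrammatic order, and is zero for cells that
-- do not compose. This makes it associative outright, so pasting computations can be done by
-- rewriting; `src` and `tgt` serve for the remaining composability conditions.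
open Classical in
noncomputable instance {A C : K} : Mul (TwoCell A C) where
  mul
    | @of _ _ _ _ _ g φ, @of _ _ _ _ g' _ ψ =>
      if h : g = g' then of (VCell.comp φ (VCell.conv h.symm rfl ψ)) else zero
    | _, _ => zero

theorem of_mul_of {A C : K} {f g g' h : A ⟶ C} (φ : VCell f g) (ψ : VCell g' h) (e : g = g') :
    of φ * of ψ = of (VCell.comp φ (VCell.conv e.symm rfl ψ)) :=
  dif_pos e

theorem of_mul_of_ne {A C : K} {f g g' h : A ⟶ C} (φ : VCell f g) (ψ : VCell g' h) (e : g ≠ g') :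
    of φ * of ψ = zero :=
  dif_neg e

@[simp]
theorem of_comp {A C : K} {f g h : A ⟶ C} (φ : VCell f g) (ψ : VCell g h) :
    of (VCell.comp φ ψ) = of φ * of ψ := by
  rw [of_mul_of φ ψ rfl]
  rfl

theorem zero_mul {A C : K} (x : TwoCell A C) : zero * x = zero := rfl

theorem mul_zero {A C : K} (x : TwoCell A C) : x * zero = zero := by
  cases x <;> rfl

noncomputable instance {A C : K} : Semigroup (TwoCell A C) where
  mul_assoc x y t := by
    rcases x with _ | @⟨f, g, φ⟩
    · rfl
    rcases y with _ | @⟨g', h, ψ⟩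
    · rfl
    rcases t with _ | @⟨h', k, χ⟩
    · simp only [mul_zero]
    by_cases h1 : g = g'
    · subst h1
      by_cases h2 : h = h'
      · subst h2
        simp only [← of_comp, VCell.comp_assoc]
      · rw [of_mul_of_ne ψ χ h2, ← of_comp, of_mul_of_ne _ χ h2, mul_zero]
    · by_cases h2 : h = h'
      · subst h2
        rw [← of_comp, of_mul_of_ne _ _ h1, of_mul_of_ne _ _ h1, zero_mul]
      · rw [of_mul_of_ne ψ χ h2, of_mul_of_ne _ _ h1, zero_mul, mul_zero]

@[simp]
theorem of_id {A C : K} (f : A ⟶ C) : of (VCell.id f) = idt f := rfl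

@[simp]
theorem of_ofEq {A C : K} {f g : A ⟶ C} (h : f = g) : of (VCell.ofEq h) = idt f :=
  of_conv _ _ _

@[simp]
theorem of_whiskerLeft {A B C : K} (e : A ⟶ B) {f g : B ⟶ C} (φ : VCell f g) :
    of (VCell.whiskerLeft e φ) = wl e (of φ) := rfl

@[simp]
theorem of_whiskerRight {A B C : K} {f g : A ⟶ B} (φ : VCell f g) (h : B ⟶ C) :
    of (VCell.whiskerRight φ h) = wr (of φ) h := rfl

@[simp]
theorem wl_wl {X A B C : K} (e' : X ⟶ A) (e : A ⟶ B) (x : TwoCell B C) :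
    wl e' (wl e x) = wl (e' ≫ e) x := by
  rcases x with _ | φ
  · rfl
  · exact of_congr (Category.assoc _ _ _).symm (Category.assoc _ _ _).symm
      (by simp only [VCell.of_whiskerLeft, PCell.cunit_comp, PCell.vcomp_assoc])

@[simp]
theorem wr_wr {A B C D : K} (x : TwoCell A B) (h : B ⟶ C) (h' : C ⟶ D) :
    wr (wr x h) h' = wr x (h ≫ h') := by
  rcases x with _ | φ
  · rfl
  · exact of_congr (Category.assoc _ _ _) (Category.assoc _ _ _)
      (by simp only [VCell.of_whiskerRight, PCell.cunit_comp, PCell.vcomp_assoc])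

@[simp]
theorem wr_wl {A B C D : K} (e : A ⟶ B) (x : TwoCell B C) (h : C ⟶ D) :
    wr (wl e x) h = wl e (wr x h) := by
  rcases x with _ | φ
  · rfl
  · exact of_congr (Category.assoc _ _ _) (Category.assoc _ _ _)
      (by simp only [VCell.of_whiskerRight, VCell.of_whiskerLeft, PCell.vcomp_assoc])

@[simp]
theorem wl_id {A C : K} (x : TwoCell A C) : wl (𝟙 A) x = x := by
  rcases x with _ | φ
  · rfl
  · exact of_congr (Category.id_comp _) (Category.id_comp _)
      (by rw [VCell.of_whiskerLeft, PCell.cunit_id, PCell.vid_vcomp _ rfl])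

@[simp]
theorem wr_id {A C : K} (x : TwoCell A C) : wr x (𝟙 C) = x := by
  rcases x with _ | φ
  · rfl
  · exact of_congr (Category.comp_id _) (Category.comp_id _)
      (by rw [VCell.of_whiskerRight, PCell.cunit_id, PCell.vcomp_vid _ rfl])

@[simp]
theorem wl_idt {A B C : K} (e : A ⟶ B) (f : B ⟶ C) : wl e (idt f) = idt (e ≫ f) :=
  congrArg of (VCell.whiskerLeft_id e f)

@[simp]
theorem wr_idt {A B C : K} (f : A ⟶ B) (e : B ⟶ C) : wr (idt f) e = idt (f ≫ e) :=
  congrArg of (VCell.id_whiskerRight f e)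

@[simp]
theorem src_of {A C : K} {f g : A ⟶ C} (φ : VCell f g) : src (of φ) = some f := rfl

@[simp]
theorem tgt_of {A C : K} {f g : A ⟶ C} (φ : VCell f g) : tgt (of φ) = some g := rfl

@[simp]
theorem src_wl {A B C : K} (e : A ⟶ B) (x : TwoCell B C) :
    src (wl e x) = (src x).map (e ≫ ·) := by
  cases x <;> rfl

@[simp]
theorem tgt_wl {A B C : K} (e : A ⟶ B) (x : TwoCell B C) :
    tgt (wl e x) = (tgt x).map (e ≫ ·) := by
  cases x <;> rfl

@[simp]
theorem src_wr {A B C : K} (x : TwoCell A B) (h : B ⟶ C) :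
    src (wr x h) = (src x).map (· ≫ h) := by
  cases x <;> rfl

@[simp]
theorem tgt_wr {A B C : K} (x : TwoCell A B) (h : B ⟶ C) :
    tgt (wr x h) = (tgt x).map (· ≫ h) := by
  cases x <;> rfl

theorem idt_mul {A C : K} {f : A ⟶ C} {x : TwoCell A C} (h : src x = some f) : idt f * x = x := by
  rcases x with _ | φ
  · rfl
  · cases h
    rw [idt, ← of_comp, VCell.id_comp]

theorem mul_idt {A C : K} {f : A ⟶ C} {x : TwoCell A C} (h : tgt x = some f) : x * idt f = x := by
  rcases x with _ | φ
  · rfl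
  · cases h
    rw [idt, ← of_comp, VCell.comp_id]

@[simp]
theorem idt_mul_idt {A C : K} (f : A ⟶ C) : idt f * idt f = idt f := idt_mul rfl

theorem src_mul {A C : K} {x y : TwoCell A C} (h : tgt x = src y) : src (x * y) = src x := by
  rcases x with _ | φ
  · rfl
  rcases y with _ | ψ
  · cases h
  cases h
  rw [← of_comp, src_of, src_of]

theorem tgt_mul {A C : K} {x y : TwoCell A C} (h : tgt x = src y) : tgt (x * y) = tgt y := by
  rcases x with _ | φ
  · rcases y with _ | ψ
    · rfl
    · cases h
  rcases y with _ | ψ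
  · rfl
  cases h
  rw [← of_comp, tgt_of, tgt_of]

/-- Composability has to be assumed because whiskering with `e` can identify distinct boundaries. -/
theorem wl_mul {A B C : K} (e : A ⟶ B) {x y : TwoCell B C} (h : tgt x = src y) :
    wl e (x * y) = wl e x * wl e y := by
  rcases x with _ | φ
  · rfl
  rcases y with _ | ψ
  · rfl
  cases h
  rw [← of_comp, ← of_whiskerLeft, VCell.whiskerLeft_comp]
  simp

theorem mul_wr {A B C : K} (e : B ⟶ C) {x y : TwoCell A B} (h : tgt x = src y) :
    wr (x * y) e = wr x e * wr y e := by
  rcases x with _ | φ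
  · rfl
  rcases y with _ | ψ
  · rfl
  cases h
  rw [← of_comp, ← of_whiskerRight, VCell.comp_whiskerRight]
  simp

theorem exchange {A B C : K} {f f' : A ⟶ B} {g g' : B ⟶ C} {x : TwoCell A B} {y : TwoCell B C}
    (hf : src x = some f) (hf' : tgt x = some f') (hg : src y = some g) (hg' : tgt y = some g') :
    wl f y * wr x g' = wr x g * wl f' y := by
  rcases x with _ | φ
  · cases hf
  rcases y with _ | ψ
  · cases hg
  cases hf
  cases hf'
  cases hg
  cases hg'
  simpa using congrArg of (VCell.exchange φ ψ)

end TwoCell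

namespace NormalLaxDoubleMonad

open TwoCell

variable {K : Type u} [DoubleCategory.{z, w, v} K] (T : NormalLaxDoubleMonad K)

/-- The action of a monad on vertical cells. -/
def mapTwo {A C : K} : TwoCell A C → TwoCell (T.obj A) (T.obj C)
  | zero => zero
  | of φ => of (T.mapV φ)

@[simp]
theorem of_mapV_eq {A C : K} {f g : A ⟶ C} (φ : VCell f g) :
    of (T.mapV φ) = T.mapTwo (of φ) := rfl

@[simp]
theorem mapTwo_idt {A C : K} (f : A ⟶ C) : T.mapTwo (idt f) = idt (T.map f) :=
  congrArg of (T.mapV_id f)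

@[simp]
theorem mapTwo_wl {A B C : K} (e : A ⟶ B) (x : TwoCell B C) :
    T.mapTwo (wl e x) = wl (T.map e) (T.mapTwo x) := by
  rcases x with _ | φ
  · rfl
  · exact of_congr (T.map_comp _ _) (T.map_comp _ _) (T.of_mapV_whiskerLeft e φ)

@[simp]
theorem mapTwo_wr {A B C : K} (x : TwoCell A B) (e : B ⟶ C) :
    T.mapTwo (wr x e) = wr (T.mapTwo x) (T.map e) := by
  rcases x with _ | φ
  · rfl
  · exact of_congr (T.map_comp _ _) (T.map_comp _ _) (T.of_mapV_whiskerRight φ e)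

@[simp]
theorem src_mapTwo {A C : K} (x : TwoCell A C) : src (T.mapTwo x) = (src x).map T.map := by
  cases x <;> rfl

@[simp]
theorem tgt_mapTwo {A C : K} (x : TwoCell A C) : tgt (T.mapTwo x) = (tgt x).map T.map := by
  cases x <;> rfl

theorem mapTwo_mul {A C : K} {x y : TwoCell A C} (h : tgt x = src y) :
    T.mapTwo (x * y) = T.mapTwo x * T.mapTwo y := by
  rcases x with _ | φ
  · rfl
  rcases y with _ | ψ
  · rfl
  cases h
  rw [← of_comp, ← of_mapV_eq, T.mapV_comp]
  simp

theorem wr_one {A C : K} (x : TwoCell A C) : wr x (T.one C) = wl (T.one A) (T.mapTwo x) := by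
  rcases x with _ | φ
  · rfl
  · exact of_congr (T.one_naturality _) (T.one_naturality _) (T.of_whiskerRight_one φ)

end NormalLaxDoubleMonad

end DoubleCategory

/-! ### Transposition along an adjunction, and free algebras -/

namespace DoubleCategory

open DoubleCategoryStruct TwoCell

namespace VCell

variable {K : Type u} [DoubleCategory.{z, w, v} K]

/-- Transposition `(f ∘ r ⇒ g) ↦ (f ⇒ g ∘ i)` along a cell `id ⇒ r ∘ i`. -/
def transpose {A S M : K} {r : S ⟶ A} {i : A ⟶ S} (η : VCell (𝟙 A) (i ≫ r)) {f : A ⟶ M}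
    {g : S ⟶ M} (α : VCell (r ≫ f) g) : VCell f (i ≫ g) :=
  comp (conv (Category.id_comp f) (Category.assoc i r f) (whiskerRight η f)) (whiskerLeft i α)

theorem of_transpose {A S M : K} {r : S ⟶ A} {i : A ⟶ S} (η : VCell (𝟙 A) (i ≫ r)) {f : A ⟶ M}
    {g : S ⟶ M} (α : VCell (r ≫ f) g) :
    of (transpose η α) = wr (of η) f * wl i (of α) := by
  simp [transpose]

/-- A transposition along a unit satisfying one of the triangle identities is injective. -/
theorem transpose_injective {A S M : K} {r : S ⟶ A} {i : A ⟶ S} {η : VCell (𝟙 A) (i ≫ r)}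
    {ε : VCell (r ≫ i) (𝟙 S)} (h : wl r (of η) * wr (of ε) r = idt r) {f : A ⟶ M} {g : S ⟶ M} :
    Function.Injective (transpose η : VCell (r ≫ f) g → VCell f (i ≫ g)) := by
  -- A left inverse of transposition: whisker with `r`, then compose with the counit. The exchange
  -- law moves the counit past `α`, and the triangle identity cancels it against the unit.
  have key (α : VCell (r ≫ f) g) : wl r (of (transpose η α)) * wr (of ε) g = of α := by
    have hε := TwoCell.exchange (x := of ε) (y := of α) rfl rfl rfl rfl
    have h' := congrArg (wr · f) h
    simp only [mul_wr, tgt_wl, tgt_of, src_wr, src_of, Option.map_some, Category.assoc, wr_wl,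
      wr_wr, wr_idt] at h'
    rw [of_transpose, wl_mul _ (by simp), wl_wl, mul_assoc, hε, wl_id, ← mul_assoc, h',
      idt_mul rfl]
  intro α β hαβ
  apply of_injective
  rw [← key α, ← key β, hαβ]

/-- The two triangle identities say `i ⊣ r`; hence precomposition with `r` is left adjoint to
precomposition with `i`. -/
theorem transpose_bijective {A S M : K} {r : S ⟶ A} {i : A ⟶ S} {η : VCell (𝟙 A) (i ≫ r)}
    {ε : VCell (r ≫ i) (𝟙 S)} (h : wl r (of η) * wr (of ε) r = idt r)
    (h' : wr (of η) i * wl i (of ε) = idt i) (f : A ⟶ M) (g : S ⟶ M) :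
    Function.Bijective (transpose η : VCell (r ≫ f) g → VCell f (i ≫ g)) := by
  refine ⟨transpose_injective h, fun θ => ?_⟩
  refine ⟨comp (whiskerLeft r θ) (conv (Category.assoc r i g) (Category.id_comp g)
    (whiskerRight ε g)), of_injective ?_⟩
  have hη := TwoCell.exchange (x := of η) (y := of θ) rfl rfl rfl rfl
  have h'' := congrArg (wr · g) h'
  simp only [mul_wr, tgt_wr, src_wl, tgt_of, src_of, Option.map_some, Category.assoc, wr_wl,
    wr_wr, wr_idt] at h''
  rw [of_transpose, TwoCell.of_comp, TwoCell.of_conv,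
    TwoCell.of_whiskerLeft, TwoCell.of_whiskerRight, wl_mul _ (by simp),
    ← mul_assoc, wl_wl, ← hη, wl_id, mul_assoc, h'', mul_idt rfl]

theorem IsInvertible.exists_mul_eq {A C : K} {f g : A ⟶ C} {φ : VCell f g} (h : IsInvertible φ) :
    ∃ ψ : VCell g f, of φ * of ψ = idt f ∧ of ψ * of φ = idt g := by
  obtain ⟨ψ, h1, h2⟩ := h
  exact ⟨ψ, by rw [← TwoCell.of_comp, h1, TwoCell.of_id],
    by rw [← TwoCell.of_comp, h2, TwoCell.of_id]⟩

theorem isInvertible_ofEq {A C : K} {f g : A ⟶ C} (h : f = g) : IsInvertible (ofEq h) := by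
  subst h
  exact ⟨VCell.id f, id_comp _, id_comp _⟩

end VCell

namespace NormalLaxDoubleMonad

variable {K : Type u} [DoubleCategory.{z, w, v} K] (T : NormalLaxDoubleMonad K)

@[simp]
theorem mul_mul (A : K) : T.map (T.mul A) ≫ T.mul A = T.mul (T.obj A) ≫ T.mul A := T.μ_μ A

@[simp]
theorem mul_mul_assoc {A B : K} (f : T.obj A ⟶ B) :
    T.map (T.mul A) ≫ T.mul A ≫ f = T.mul (T.obj A) ≫ T.mul A ≫ f := by
  rw [← Category.assoc, mul_mul, Category.assoc]

@[simp]
theorem one_mul (A : K) : T.one (T.obj A) ≫ T.mul A = 𝟙 (T.obj A) := T.ι_μ A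

@[simp]
theorem one_mul_assoc {A B : K} (f : T.obj A ⟶ B) : T.one (T.obj A) ≫ T.mul A ≫ f = f := by
  rw [← Category.assoc, one_mul, Category.id_comp]

@[simp]
theorem map_one_mul (A : K) : T.map (T.one A) ≫ T.mul A = 𝟙 (T.obj A) := T.map_ι_μ A

@[simp]
theorem map_one_mul_assoc {A B : K} (f : T.obj A ⟶ B) :
    T.map (T.one A) ≫ T.mul A ≫ f = f := by
  rw [← Category.assoc, map_one_mul, Category.id_comp]

@[simp]
theorem map_map_mul {A C : K} (f : A ⟶ C) :
    T.map (T.map f) ≫ T.mul C = T.mul A ≫ T.map f := T.mul_naturality f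

@[simp]
theorem map_map_mul_assoc {A B C : K} (f : A ⟶ C) (g : T.obj C ⟶ B) :
    T.map (T.map f) ≫ T.mul C ≫ g = T.mul A ≫ T.map f ≫ g := by
  rw [← Category.assoc, map_map_mul, Category.assoc]

theorem comp_one {A C : K} (f : A ⟶ C) : f ≫ T.one C = T.one A ≫ T.map f := T.one_naturality f

theorem comp_one_assoc {A B C : K} (f : A ⟶ C) (g : T.obj C ⟶ B) :
    f ≫ T.one C ≫ g = T.one A ≫ T.map f ≫ g := by
  rw [← Category.assoc, comp_one, Category.assoc]

/-- The free algebra on an object. -/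
abbrev free (A : K) : T.PseudoAlgebra (T.obj A) where
  act := T.mul A
  associator := VCell.ofEq (T.mul_mul A)
  unitor := VCell.ofEq (T.one_mul A).symm
  associator_invertible := VCell.isInvertible_ofEq _
  unitor_invertible := VCell.isInvertible_ofEq _
  assoc_coherence := of_injective (by simp)
  unit_coherence := of_injective (by simp)
  unit_coherence' := of_injective (by simp)

theorem of_free_associator (A : K) :
    of (T.free A).associator = idt (T.mul (T.obj A) ≫ T.mul A) := by
  simp

theorem of_free_unitor (A : K) : of (T.free A).unitor = idt (𝟙 (T.obj A)) := by
  simp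

theorem free_isStrict (A : K) : (T.free A).IsStrict :=
  ⟨⟨T.mul_mul A, rfl⟩, ⟨(T.one_mul A).symm, rfl⟩⟩

variable {T}

theorem PseudoAlgebra.of_unit_coherence {M : K} (Z : T.PseudoAlgebra M) :
    wr (T.mapTwo (of Z.unitor)) Z.act * wl (T.map (T.one M)) (of Z.associator) = idt Z.act := by
  simpa using congrArg of Z.unit_coherence

theorem PseudoAlgebra.of_unit_coherence' {M : K} (Z : T.PseudoAlgebra M) :
    wl Z.act (of Z.unitor) * wl (T.one (T.obj M)) (of Z.associator) = idt Z.act := by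
  simpa using congrArg of Z.unit_coherence'

/-- The two axioms with all transports removed. -/
theorem isColaxMorphism_iff {A C : K} (X : T.PseudoAlgebra A) (Y : T.PseudoAlgebra C) (f : A ⟶ C)
    (fbar : VCell (X.act ≫ f) (T.map f ≫ Y.act)) :
    IsColaxMorphism X Y f fbar ↔
      (wl (T.map X.act) (of fbar) * wr (T.mapTwo (of fbar)) Y.act *
          wl (T.map (T.map f)) (of Y.associator) =
        wr (of X.associator) f * wl (T.mul A) (of fbar)) ∧
      wr (of X.unitor) f * wl (T.one A) (of fbar) = wl f (of Y.unitor) := by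
  constructor
  · rintro ⟨h1, h2⟩
    exact ⟨by simpa using congrArg of h1, by simpa using congrArg of h2⟩
  · rintro ⟨h1, h2⟩
    exact ⟨of_injective (by simpa using h1), of_injective (by simpa using h2)⟩

/-- The counit of the adjunction between the unit and the multiplication of a colax-idempotent
monad. -/
theorem exists_counit_free (hT : T.IsColaxIdempotent) (A : K) :
    ∃ ζ : VCell (T.mul A ≫ T.one (T.obj A)) (𝟙 (T.obj (T.obj A))),
      wl (T.one (T.obj A)) (of ζ) = idt (T.one (T.obj A)) ∧
        wr (of ζ) (T.mul A) = idt (T.mul A) := by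
  -- The counit is the colax structure on the unit of `T.obj A`, seen as a morphism of free
  -- algebras; its target is an identity by a unit law of the monad. Its unit axiom is the first
  -- triangle identity.
  obtain ⟨ζ, hζ, -⟩ := hT (T.free A) (T.free (T.obj A)) (T.free_isStrict A) (T.free_isStrict _)
    (T.one (T.obj A))
  rw [isColaxMorphism_iff] at hζ
  obtain ⟨h1, h2⟩ := hζ
  let ζ' : VCell (T.mul A ≫ T.one (T.obj A)) (𝟙 (T.obj (T.obj A))) :=
    VCell.conv rfl (T.map_one_mul (T.obj A)) ζ
  have hζ' : of ζ' = of ζ := of_conv _ _ _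
  have e1 : wl (T.one (T.obj A)) (of ζ) = idt (T.one (T.obj A)) := by
    have : src (wl (T.one (T.obj A)) (of ζ)) = some (T.one (T.obj A)) := by
      rw [← hζ']
      simp
    have h2' : idt (T.one (T.obj A)) * wl (T.one (T.obj A)) (of ζ) = idt (T.one (T.obj A)) := by
      simpa [free] using h2
    rwa [idt_mul this] at h2'
  refine ⟨ζ', by rw [hζ', e1], ?_⟩
  have key (ξ : VCell (T.mul A ≫ 𝟙 (T.obj A)) (T.map (𝟙 (T.obj A)) ≫ T.mul A))
      (h1 : wl (T.map (T.mul A)) (of ξ) * wr (T.mapTwo (of ξ)) (T.mul A) =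
        wl (T.mul (T.obj A)) (of ξ))
      (h2 : wl (T.one (T.obj A)) (of ξ) = idt (𝟙 (T.obj A))) :
      IsColaxMorphism (T.free A) (T.free A) (𝟙 (T.obj A)) ξ := by
    refine (isColaxMorphism_iff _ _ _ _).2 ⟨?_, ?_⟩
    · rw [h1, of_free_associator, wr_idt, wl_idt, mul_idt (by simp), idt_mul (by simp)]
    · rw [h2, of_free_unitor]
      simp
  -- The second triangle identity comes from uniqueness: the identity cell and `ζ` followed by the
  -- multiplication are both colax structures on the identity of the free algebra.
  let ξ₁ : VCell (T.mul A ≫ 𝟙 (T.obj A)) (T.map (𝟙 (T.obj A)) ≫ T.mul A) :=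
    VCell.ofEq (by simp)
  let ξ₂ : VCell (T.mul A ≫ 𝟙 (T.obj A)) (T.map (𝟙 (T.obj A)) ≫ T.mul A) :=
    VCell.conv (by simp) (by simp) (VCell.whiskerRight ζ' (T.mul A))
  have hξ₁ : of ξ₁ = idt (T.mul A) := by simp [ξ₁]
  have hξ₂ : of ξ₂ = wr (of ζ) (T.mul A) := by simp [ξ₂, hζ']
  have := (hT (T.free A) (T.free A) (T.free_isStrict A) (T.free_isStrict A) (𝟙 _)).unique
    (key ξ₁ (by simp [hξ₁]) (by simp [hξ₁])) (key ξ₂ ?_ ?_)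
  · rw [hζ', ← hξ₁, this, hξ₂]
  · have h := congrArg (wr · (T.mul A)) h1
    rw [of_free_associator, of_free_associator, wr_idt, wl_idt,
      mul_idt (by rw [tgt_mul (by simp)]; simp), idt_mul (by simp),
      mul_wr _ (by simp [free])] at h
    simpa [hξ₂] using h
  · rw [hξ₂, ← wr_wl, e1]
    simp

end NormalLaxDoubleMonad

end DoubleCategory

/-! ### Algebra actions as right adjoints, and colax morphisms -/

namespace DoubleCategory

open DoubleCategoryStruct TwoCell

namespace VCell

variable {K : Type u} [DoubleCategory.{z, w, v} K]

/-- `η : d ⇒ l ∘ j` defines `l` as the left Kan extension of `d` along `j` in the vertical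
2-category. -/
def IsLeftKan {A B M : K} {j : A ⟶ B} {d : A ⟶ M} {l : B ⟶ M}
    (η : VCell d (j ≫ l)) : Prop :=
  ∀ k : B ⟶ M, Function.Bijective fun ψ : VCell l k => VCell.comp η (VCell.whiskerLeft j ψ)

end VCell

namespace NormalLaxDoubleMonad

variable {K : Type u} [DoubleCategory.{z, w, v} K] {T : NormalLaxDoubleMonad K}

/-- The cell between the two units of a free algebra that exhibits a monad as colax-idempotent. -/
theorem exists_comparison (hT : T.IsColaxIdempotent) (A : K) :
    ∃ lam : VCell (T.one (T.obj A)) (T.map (T.one A)),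
      wl (T.one A) (of lam) = idt (T.one A ≫ T.map (T.one A)) ∧
        wr (of lam) (T.mul A) = idt (𝟙 (T.obj A)) := by
  obtain ⟨ζ, h1, h2⟩ := exists_counit_free hT A
  -- The comparison is `ζ` whiskered with `T.map (T.one A)`, which is a section of the
  -- multiplication.
  refine ⟨VCell.conv (by rw [map_one_mul_assoc]) (Category.comp_id _)
    (VCell.whiskerLeft (T.map (T.one A)) ζ), ?_, ?_⟩
  · rw [of_conv, of_whiskerLeft, wl_wl, ← comp_one, ← wl_wl, h1, wl_idt]
  · rw [of_conv, of_whiskerLeft, wr_wl, h2, wl_idt, map_one_mul]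

/-- The action of a pseudo algebra for a colax-idempotent monad is right adjoint to the unit, with
the unitor of the algebra as unit. -/
theorem PseudoAlgebra.exists_counit (hT : T.IsColaxIdempotent) {A : K} (X : T.PseudoAlgebra A) :
    ∃ ε : VCell (X.act ≫ T.one A) (𝟙 (T.obj A)),
      wl X.act (of X.unitor) * wr (of ε) X.act = idt X.act ∧
        wr (of X.unitor) (T.one A) * wl (T.one A) (of ε) = idt (T.one A) := by
  obtain ⟨lam, h1, h2⟩ := exists_comparison hT A
  obtain ⟨v, hv1, hv2⟩ := X.unitor_invertible.exists_mul_eq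
  -- The counit is $\iota_A\circ a=Ta\circ\iota_{TA}\Rightarrow Ta\circ
  -- T\iota_A\Rightarrow\mathrm{id}$: the comparison cell followed by the image of the inverse
  -- unitor.
  let ε : VCell (X.act ≫ T.one A) (𝟙 (T.obj A)) :=
    VCell.comp (VCell.conv (T.comp_one X.act).symm (T.map_comp _ _).symm
      (VCell.whiskerRight lam (T.map X.act))) (VCell.conv rfl (T.map_id A) (T.mapV v))
  have hε : of ε = wr (of lam) (T.map X.act) * T.mapTwo (of v) := by simp [ε]
  refine ⟨ε, ?_, ?_⟩
  -- The comparison becomes trivial after the multiplication, so exchanging it with the associator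
  -- relates the associator at `T.one (T.obj A)` to that at `T.map (T.one A)`. The latter is the
  -- image of the inverse unitor by one unit coherence; the other unit coherence then gives the
  -- triangle.
  · have e1 := TwoCell.exchange (x := of lam) (y := of X.associator) rfl rfl rfl rfl
    rw [← wr_wr _ (T.mul A), h2, wr_idt, Category.id_comp, mul_idt (by simp)] at e1
    have e2 := X.of_unit_coherence
    have e3 : wr (T.mapTwo (of v)) X.act =
        wl (T.map (T.one A)) (of X.associator) := by
      have := congrArg (wr (T.mapTwo (of v)) X.act * ·) e2
      rw [← mul_assoc, ← mul_wr _ (by simp), ← T.mapTwo_mul (by simp), hv2, mapTwo_idt, wr_idt,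
        idt_mul (by simp), mul_idt (by simp)] at this
      exact this.symm
    rw [hε, mul_wr _ (by simp), wr_wr, e3, ← e1, X.of_unit_coherence']
  · rw [hε, wl_mul _ (by simp), ← wr_wl, h1, ← T.wr_one, wr_idt,
      idt_mul (by simp [T.comp_one, ← T.comp_one_assoc (T.one A)]),
      ← mul_wr _ (by simp), hv1]
    simp

/-- Between pseudo algebras for a colax-idempotent monad, the unit axiom of a colax morphism implies
the associativity axiom. -/
theorem isColaxMorphism_iff_transpose (hT : T.IsColaxIdempotent) {A C : K} (X : T.PseudoAlgebra A)
    (Y : T.PseudoAlgebra C) (f : A ⟶ C) (fbar : VCell (X.act ≫ f) (T.map f ≫ Y.act)) :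
    IsColaxMorphism X Y f fbar ↔
      of (VCell.transpose X.unitor fbar) = wl f (of Y.unitor) := by
  rw [isColaxMorphism_iff, VCell.of_transpose]
  refine and_iff_right_of_imp fun h => ?_
  obtain ⟨ε, h1, -⟩ := X.exists_counit hT
  -- The image under `T` of the adjunction between unit and action. Both sides `L` and `R` of the
  -- associativity axiom are transposed along it, and both transposes reduce to `fbar`: for `L` by
  -- the unit axiom and unit coherence of `Y`, for `R` by unit coherence of `X`.
  let Tu : VCell (𝟙 (T.obj A)) (T.map (T.one A) ≫ T.map X.act) :=
    VCell.conv (T.map_id A) (T.map_comp _ _) (T.mapV X.unitor)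
  let Te : VCell (T.map X.act ≫ T.map (T.one A)) (𝟙 (T.obj (T.obj A))) :=
    VCell.conv (T.map_comp _ _) (T.map_id _) (T.mapV ε)
  have hTu : of Tu = T.mapTwo (of X.unitor) := by simp [Tu]
  have hTe : of Te = T.mapTwo (of ε) := by simp [Te]
  have tri : wl (T.map X.act) (of Tu) * wr (of Te) (T.map X.act) = idt (T.map X.act) := by
    rw [hTu, hTe, ← T.mapTwo_wl, ← T.mapTwo_wr, ← T.mapTwo_mul (by simp), h1, T.mapTwo_idt]
  let L : VCell (T.map X.act ≫ X.act ≫ f) (T.mul A ≫ T.map f ≫ Y.act) :=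
    VCell.comp (VCell.comp (VCell.whiskerLeft (T.map X.act) fbar)
      (VCell.conv (by simp) (by simp) (VCell.whiskerRight (T.mapV fbar) Y.act)))
        (VCell.conv rfl (by simp) (VCell.whiskerLeft (T.map (T.map f)) Y.associator))
  let R : VCell (T.map X.act ≫ X.act ≫ f) (T.mul A ≫ T.map f ≫ Y.act) :=
    VCell.comp (VCell.conv (by simp) (by simp) (VCell.whiskerRight X.associator f))
      (VCell.whiskerLeft (T.mul A) fbar)
  have hL : of L = wl (T.map X.act) (of fbar) * (wr (T.mapTwo (of fbar)) Y.act *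
      wl (T.map (T.map f)) (of Y.associator)) := by simp [L, mul_assoc]
  have hR : of R = wr (of X.associator) f * wl (T.mul A) (of fbar) := by simp [R]
  suffices hLR : L = R by rw [← hR, mul_assoc, ← hL, hLR]
  refine VCell.transpose_injective tri (of_injective ?_)
  rw [VCell.of_transpose, VCell.of_transpose, hTu, hL, hR,
    wl_mul _ (by rw [src_mul (by simp)]; simp), wl_mul _ (by simp), wl_mul _ (by simp),
    wl_wl, wl_wl, wl_wl, T.map_one_mul, wl_id, ← mul_assoc, ← mul_assoc]
  have e1 := TwoCell.exchange (x := T.mapTwo (of X.unitor)) (y := of fbar)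
    (f := 𝟙 _) (f' := T.map (T.one A) ≫ T.map X.act) (by simp) (by simp) rfl rfl
  have e2 := congrArg (fun x => wr (T.mapTwo x) Y.act) h
  rw [T.mapTwo_mul (by simp), mul_wr _ (by simp), T.mapTwo_wr, wr_wr, T.mapTwo_wl, wr_wl,
    T.mapTwo_wl, wr_wl] at e2
  have e3 := congrArg (wl (T.map f)) Y.of_unit_coherence
  rw [wl_mul _ (by simp), wl_wl] at e3
  have e4 : T.map (T.one A) ≫ T.map (T.map f) = T.map f ≫ T.map (T.one C) := by
    rw [← T.map_comp, ← T.comp_one, T.map_comp]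
  have e5 := congrArg (wr · f) X.of_unit_coherence
  rw [mul_wr _ (by simp), wr_wr, wr_wl, wr_idt] at e5
  rw [← e1, wl_id, ← mul_assoc, e5, idt_mul rfl, mul_assoc (of fbar), e2, e4, mul_assoc, e3,
    wl_idt, mul_idt rfl]

/-- The unit axiom prescribes the transpose of `fbar`, and transposition is bijective. -/
theorem existsUnique_isColaxMorphism (hT : T.IsColaxIdempotent) {A C : K} (X : T.PseudoAlgebra A)
    (Y : T.PseudoAlgebra C) (f : A ⟶ C) :
    ∃! fbar : VCell (X.act ≫ f) (T.map f ≫ Y.act), IsColaxMorphism X Y f fbar := by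
  obtain ⟨ε, h1, h2⟩ := X.exists_counit hT
  let θ : VCell f (T.one A ≫ T.map f ≫ Y.act) :=
    VCell.conv (Category.comp_id f) (T.comp_one_assoc f Y.act) (VCell.whiskerLeft f Y.unitor)
  have hθ : of θ = wl f (of Y.unitor) := by simp [θ]
  simp only [isColaxMorphism_iff_transpose hT, ← hθ, of_inj]
  exact (VCell.transpose_bijective h1 h2 _ _).existsUnique θ

/-! ### Left Kan extensions in the vertical 2-category -/

open VCell in
/-- The action of a colax morphism `j` between algebras for a colax-idempotent monad preserves
left Kan extensions along `j`, being given by right adjoints. -/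
theorem isLeftKan_act (hT : T.IsColaxIdempotent) {A B M : K} (X : T.PseudoAlgebra A)
    (Y : T.PseudoAlgebra B) {j : A ⟶ B} {jbar : VCell (X.act ≫ j) (T.map j ≫ Y.act)}
    (hj : IsColaxMorphism X Y j jbar) {d : A ⟶ M} {l : B ⟶ M} {η : VCell d (j ≫ l)}
    (hη : VCell.IsLeftKan η) {κ : VCell (X.act ≫ d) (T.map j ≫ Y.act ≫ l)}
    (hκ : of κ = wl X.act (of η) * wr (of jbar) l) : VCell.IsLeftKan κ := by
  intro k
  obtain ⟨ε, hε, hε'⟩ := X.exists_counit hT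
  obtain ⟨δ, hδ, hδ'⟩ := Y.exists_counit hT
  rw [isColaxMorphism_iff] at hj
  let cv : VCell d (T.one A ≫ T.map j ≫ k) ≃ VCell d (j ≫ T.one B ≫ k) :=
    { toFun := conv rfl (T.comp_one_assoc j k).symm
      invFun := conv rfl (T.comp_one_assoc j k)
      left_inv := fun _ => TwoCell.of_injective (by simp)
      right_inv := fun _ => TwoCell.of_injective (by simp) }
  have hX := transpose_bijective hε hε' d (T.map j ≫ k)
  have hY := transpose_bijective hδ hδ' l k
  -- Up to transposition along the adjunctions of `X` and `Y`, composing with `κ` is composing with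
  -- `η`. The unit axiom of `jbar` makes this square commute; three of its sides are bijective,
  -- hence so is the fourth.
  have comm (ψ : VCell (Y.act ≫ l) k) :
      cv (transpose X.unitor (comp κ (whiskerLeft (T.map j) ψ))) =
        comp η (whiskerLeft j (transpose Y.unitor ψ)) := by
    apply TwoCell.of_injective
    have e1 := TwoCell.exchange (x := of X.unitor) (y := of η) rfl rfl rfl rfl
    have e2 := congrArg (wr · l) hj.2
    rw [mul_wr _ (by simp), wr_wr, wr_wl, wr_wl] at e2
    simp only [cv, Equiv.coe_fn_mk, TwoCell.of_conv, of_transpose, TwoCell.of_comp,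
      TwoCell.of_whiskerLeft, hκ]
    rw [wl_mul _ (by rw [tgt_mul (by simp)]; simp), wl_mul _ (by simp), wl_mul _ (by simp),
      wl_wl, wl_wl, wl_wl, ← mul_assoc, ← mul_assoc, ← e1, wl_id, mul_assoc (of η), e2,
      ← T.comp_one, mul_assoc]
  have h2 : Function.Bijective fun ψ : VCell (Y.act ≫ l) k =>
      cv (transpose X.unitor (comp κ (whiskerLeft (T.map j) ψ))) := by
    simp only [comm]
    exact (hη _).comp hY
  exact (Function.Bijective.of_comp_iff' (cv.bijective.comp hX) _).1 h2

end NormalLaxDoubleMonad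

namespace VCell

variable {K : Type u} [DoubleCategory.{z, w, v} K] {A B M : K} {j : A ⟶ B} {d d' : A ⟶ M}
  {l l' : B ⟶ M}

/-- A cell compared to a left Kan extension along invertible cells is a left Kan extension if and
only if the comparison is invertible. -/
theorem IsLeftKan.isInvertible_iff {κ : VCell d (j ≫ l)} (hκ : IsLeftKan κ) {θ : VCell d' (j ≫ l')}
    {α : VCell d d'} (hα : IsInvertible α) {β : VCell l l'}
    (h : comp α θ = comp κ (whiskerLeft j β)) : IsInvertible β ↔ IsLeftKan θ := by
  obtain ⟨α', h1, h2⟩ := hα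
  have key (k : B ⟶ M) (ψ : VCell l' k) :
      comp α (comp θ (whiskerLeft j ψ)) = comp κ (whiskerLeft j (comp β ψ)) := by
    rw [← comp_assoc, h, comp_assoc, whiskerLeft_comp]
  have hb (k : A ⟶ M) : Function.Bijective (comp α : VCell d' k → VCell d k) :=
    Function.bijective_iff_has_inverse.2 ⟨comp α',
      fun x => by rw [← comp_assoc, h2, id_comp], fun x => by rw [← comp_assoc, h1, id_comp]⟩
  -- Since composing with `α` and with `κ` is bijective, the universal property of `θ` at `k`
  -- amounts to bijectivity of composing with `β`.
  have iff (k : B ⟶ M) : (Function.Bijective fun ψ : VCell l' k => comp θ (whiskerLeft j ψ)) ↔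
      Function.Bijective (comp β : VCell l' k → VCell l k) := by
    rw [← Function.Bijective.of_comp_iff' (hb _), ← Function.Bijective.of_comp_iff' (hκ k)]
    simp only [Function.comp_def, key]
  constructor
  · rintro ⟨β', h3, h4⟩ k
    rw [iff]
    exact Function.bijective_iff_has_inverse.2 ⟨comp β',
      fun x => by rw [← comp_assoc, h4, id_comp], fun x => by rw [← comp_assoc, h3, id_comp]⟩
  · intro hθ
    -- As in the Yoneda lemma: surjectivity gives a one-sided inverse, injectivity makes it
    -- two-sided.
    obtain ⟨β', h3⟩ := ((iff l).1 (hθ l)).2 (VCell.id l)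
    refine ⟨β', h3, ((iff l').1 (hθ l')).1 ?_⟩
    rw [← comp_assoc, h3, id_comp, comp_id]

end VCell

namespace NormalLaxDoubleMonad

open VCell

variable {K : Type u} [DoubleCategory.{z, w, v} K] {T : NormalLaxDoubleMonad K}

/-- The colax structure `lbar` compares the Kan extension `κ` with `θ`, through `dbar`. -/
theorem isInvertible_iff_isLeftKan_map (hT : T.IsColaxIdempotent) {A B M : K}
    (X : T.PseudoAlgebra A) (Y : T.PseudoAlgebra B) (Z : T.PseudoAlgebra M) {j : A ⟶ B}
    {d : A ⟶ M} {l : B ⟶ M} {η : VCell d (j ≫ l)} (hη : VCell.IsLeftKan η)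
    {dbar : VCell (X.act ≫ d) (T.map d ≫ Z.act)} {lbar : VCell (Y.act ≫ l) (T.map l ≫ Z.act)}
    (hd : IsColaxMorphism X Z d dbar) (hl : IsColaxMorphism Y Z l lbar) (hi : IsInvertible dbar)
    {θ : VCell (T.map d ≫ Z.act) (T.map j ≫ T.map l ≫ Z.act)}
    (hθ : of θ = wr (T.mapTwo (of η)) Z.act) :
    IsInvertible lbar ↔ VCell.IsLeftKan θ := by
  obtain ⟨jbar, hj, -⟩ := existsUnique_isColaxMorphism hT X Y j
  let κ : VCell (X.act ≫ d) (T.map j ≫ Y.act ≫ l) :=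
    comp (whiskerLeft X.act η) (conv (Category.assoc _ _ _) (Category.assoc _ _ _)
      (whiskerRight jbar l))
  have hκ : of κ = wl X.act (of η) * wr (of jbar) l := by simp [κ]
  refine (isLeftKan_act hT X Y hj hη hκ).isInvertible_iff hi ?_
  obtain ⟨ε, hε, -⟩ := X.exists_counit hT
  -- Both transposes equal `η` followed by the unitor of `Z` whiskered with `j ≫ l`: on one side by
  -- the unit axiom of `dbar` and naturality of the monad unit, on the other by the unit axioms of
  -- `jbar` and `lbar`.
  refine transpose_injective hε (TwoCell.of_injective ?_)
  rw [isColaxMorphism_iff] at hj hd hl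
  have e1 := TwoCell.exchange (x := of X.unitor) (y := of η) rfl rfl rfl rfl
  have e2 := congrArg (wr · l) hj.2
  rw [mul_wr _ (by simp), wr_wr, wr_wl, wr_wl] at e2
  have e3 := TwoCell.exchange (x := of η) (y := of Z.unitor) rfl rfl rfl rfl
  have e4 := congrArg (wl j) hl.2
  rw [wl_mul _ (by simp), wl_wl, wl_wl] at e4
  rw [of_transpose, of_transpose, TwoCell.of_comp, TwoCell.of_comp, hθ, hκ, TwoCell.of_whiskerLeft]
  rw [wl_mul _ (by simp), ← mul_assoc, hd.2, wl_mul _ (by rw [tgt_mul (by simp)]; simp),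
    wl_mul _ (by simp), wl_wl, wl_wl, ← mul_assoc, ← mul_assoc, ← e1, wl_id, mul_assoc (of η), e2,
    ← wr_wl, ← T.wr_one, wr_wr, e3, ← T.comp_one, mul_assoc, e4, wr_id]

end NormalLaxDoubleMonad

end DoubleCategory

/-! ### Companions: from horizontal to vertical Kan extensions -/

namespace DoubleCategory

open DoubleCategoryStruct PCell

variable {K : Type u} [DoubleCategory.{z, w, v} K]

/-- The identities that exhibit `φ` and `ψ` as the structure cells of a companion of `j`. -/
structure IsCompanionPair {A B : K} {j : A ⟶ B} {J : Hor A B} (φ : Cell J j (𝟙 B) (hunit B))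
    (ψ : Cell (hunit A) (𝟙 A) j J) : Prop where
  unit_vcomp_counit : of ψ ⋄ of φ = of (cunit j)
  unit_hcomp_counit :
    of (leftUnitorInv J) ⋄ hcomp (of ψ) (of φ) ⋄ of (rightUnitor J) = of (vid J)

/-- The cell `ψ` is the factorization of the unit cell of `j` through the cartesian cell. The second
identity holds because both sides have the same composite with that cell. In this equational form
companions are preserved by `T`, which need not preserve cartesian cells. -/
theorem IsCompanion.exists_isCompanionPair {A B : K} {j : A ⟶ B} {J : Hor A B}
    {φ : Cell J j (𝟙 B) (hunit B)} (h : IsCompanion j J φ) :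
    ∃ ψ : Cell (hunit A) (𝟙 A) j J, IsCompanionPair φ ψ := by
  obtain ⟨ψ, hψ, -⟩ := h (hunit A) (𝟙 A) j
    (recast rfl (Category.id_comp j).symm (Category.comp_id j).symm rfl (cunit j))
  have h1 : of ψ ⋄ of φ = of (cunit j) := by
    rw [← of_vcomp, hψ, of_recast]
  refine ⟨ψ, h1, ?_⟩
  have e : of (pre (leftUnitorInv J) (post (ccomp ψ φ) (rightUnitor J))) =
      of (leftUnitorInv J) ⋄ hcomp (of ψ) (of φ) ⋄ of (rightUnitor J) := by
    rw [of_pre, of_post, of_ccomp]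
  rw [← e]
  refine congrArg of ((h J (𝟙 A) (𝟙 B) (vcomp (vid J) φ)).unique (of_injective ?_) rfl)
  have h2 : of φ ⋄ of (cunit (𝟙 B)) = of φ := by rw [cunit_id, vcomp_vid _ rfl]
  rw [of_vcomp, e, vcomp_assoc, vcomp_assoc, ← rightUnitor_naturality, ← vcomp_assoc (hcomp _ _),
    ← interchange _ _ _ _ rfl rfl rfl rfl, h1, h2, ← leftUnitor_hunit, leftUnitor_naturality,
    VCell.inv_unitor_vcomp _ φ rfl, of_vcomp, vid_vcomp _ rfl]

/-- Composition with the unit of a companion of `j`, which turns cells out of the companion into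
vertical cells. -/
def companionTranspose {A B M : K} {j : A ⟶ B} {J : Hor A B} (ψ : Cell (hunit A) (𝟙 A) j J)
    {p : A ⟶ M} {q : B ⟶ M} (α : Cell J p q (hunit M)) : VCell p (j ≫ q) :=
  recast rfl (Category.id_comp p) rfl rfl (vcomp ψ α)

theorem of_companionTranspose {A B M : K} {j : A ⟶ B} {J : Hor A B}
    (ψ : Cell (hunit A) (𝟙 A) j J) {p : A ⟶ M} {q : B ⟶ M} (α : Cell J p q (hunit M)) :
    of (companionTranspose ψ α) = of ψ ⋄ of α := by
  rw [companionTranspose, of_recast, of_vcomp]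

/-- The inverse pastes a vertical cell with `φ` followed by the unit cell of `q`; each companion
identity gives one of the two inverse laws. -/
theorem IsCompanionPair.bijective {A B M : K} {j : A ⟶ B} {J : Hor A B}
    {φ : Cell J j (𝟙 B) (hunit B)} {ψ : Cell (hunit A) (𝟙 A) j J} (h : IsCompanionPair φ ψ)
    (p : A ⟶ M) (q : B ⟶ M) :
    Function.Bijective (companionTranspose ψ : Cell J p q (hunit M) → VCell p (j ≫ q)) := by
  let back (θ : VCell p (j ≫ q)) : Cell J p q (hunit M) :=
    pre (leftUnitorInv J) (hpaste θ
      (recast rfl rfl (Category.id_comp q) rfl (vcomp φ (cunit q))))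
  have hback (θ : VCell p (j ≫ q)) : of (back θ) =
      of (leftUnitorInv J) ⋄ hcomp (of θ) (of φ ⋄ of (cunit q)) ⋄ of (leftUnitor (hunit M)) := by
    simp only [back, hpaste, of_pre, of_post, of_ccomp, of_recast, of_vcomp]
  refine Function.bijective_iff_has_inverse.2 ⟨back, fun α => of_injective ?_,
    fun θ => of_injective ?_⟩
  · rw [hback, of_companionTranspose, interchange _ _ _ _ rfl rfl rfl rfl, vcomp_assoc,
      leftUnitor_hunit, rightUnitor_naturality, ← vcomp_assoc (hcomp _ _), ← vcomp_assoc,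
      h.unit_hcomp_counit, vid_vcomp _ rfl]
  · have h1 : of (cunit (𝟙 A)) ⋄ of θ = of θ := by rw [cunit_id, vid_vcomp _ rfl]
    have h2 : of ψ ⋄ of φ ⋄ of (cunit q) = of (VCell.id (j ≫ q)) := by
      rw [← vcomp_assoc, h.unit_vcomp_counit, ← cunit_comp]
      rfl
    have h3 := interchange (cunit (𝟙 A)) ψ θ (vcomp φ (cunit q)) rfl rfl rfl rfl
    rw [of_vcomp, h1, h2] at h3
    rw [of_companionTranspose, hback, ← vcomp_assoc, leftUnitorInv_naturality, vcomp_assoc,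
      ← vcomp_assoc (hcomp _ _), ← h3, ← VCell.of_comp, VCell.comp_id]

theorem companionTranspose_hpaste {A B M : K} {j : A ⟶ B} {J : Hor A B}
    (ψ : Cell (hunit A) (𝟙 A) j J) {d : A ⟶ M} {l k : B ⟶ M} (η : Cell J d l (hunit M))
    (ξ : VCell l k) :
    companionTranspose ψ (pre (rightUnitorInv J) (hpaste η ξ)) =
      VCell.comp (companionTranspose ψ η) (VCell.whiskerLeft j ξ) := by
  apply of_injective
  rw [of_companionTranspose, of_pre, hpaste, of_post, of_ccomp, VCell.of_comp,
    of_companionTranspose, VCell.of_whiskerLeft, interchange _ _ _ _ rfl rfl rfl rfl,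
    ← vcomp_assoc, rightUnitorInv_naturality, VCell.leftUnitorInv_hunit, vcomp_assoc, vcomp_assoc]

/-- Left Kan extensions along a companion of `j` are left Kan extensions along `j` in the vertical
2-category. -/
theorem IsCompanionPair.isLeftKan_iff {A B M : K} {j : A ⟶ B} {J : Hor A B}
    {φ : Cell J j (𝟙 B) (hunit B)} {ψ : Cell (hunit A) (𝟙 A) j J} (h : IsCompanionPair φ ψ)
    {d : A ⟶ M} {l : B ⟶ M} (η : Cell J d l (hunit M)) :
    IsLeftKan η ↔ VCell.IsLeftKan (companionTranspose ψ η) := by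
  refine forall_congr' fun k => ?_
  have e : (∀ χ : Cell J d k (hunit M), ∃! ξ : VCell l k,
      χ = pre (rightUnitorInv J) (hpaste η ξ)) ↔
      Function.Bijective fun ξ : VCell l k => pre (rightUnitorInv J) (hpaste η ξ) := by
    simp only [Function.bijective_iff_existsUnique, eq_comm]
  rw [e, ← Function.Bijective.of_comp_iff' (h.bijective d k)]
  simp only [Function.comp_def, companionTranspose_hpaste]

/-- The pointwise property at the horizontal unit of `B`, up to the right unitor. -/
theorem IsPointwiseLeftKan.isLeftKan {A B M : K} {J : Hor A B} {d : A ⟶ M} {l : B ⟶ M}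
    {η : Cell J d l (hunit M)} (h : IsPointwiseLeftKan η) : IsLeftKan η := by
  intro k χ
  have e (ξ : VCell l k) : χ = pre (rightUnitorInv J) (hpaste η ξ) ↔
      pre (rightUnitor J) χ = hpaste η ξ := by
    constructor
    · rintro rfl
      apply of_injective
      rw [of_pre, of_pre, ← vcomp_assoc, rightUnitor_inv, vid_vcomp _ rfl]
    · intro e
      rw [← e]
      apply of_injective
      rw [of_pre, of_pre, ← vcomp_assoc, inv_rightUnitor, vid_vcomp _ rfl]
  simp only [e]
  exact h (hunit B) k _

namespace NormalLaxDoubleMonad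

variable (T : NormalLaxDoubleMonad K)

/-- The image under a normal lax double functor of the unit of a companion. -/
def mapCompanionUnit {A B : K} {j : A ⟶ B} {J : Hor A B} (ψ : Cell (hunit A) (𝟙 A) j J) :
    Cell (hunit (T.obj A)) (𝟙 (T.obj A)) (T.map j) (T.hor J) :=
  recast (T.normal.hor_hunit A) (T.map_id A) rfl rfl (T.cell ψ)

/-- Normal lax double functors preserve companions. -/
theorem map_isCompanionPair {A B : K} {j : A ⟶ B} {J : Hor A B}
    {φ : Cell J j (𝟙 B) (hunit B)} {ψ : Cell (hunit A) (𝟙 A) j J} (h : IsCompanionPair φ ψ) :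
    IsCompanionPair (recast rfl rfl (T.map_id B) (T.normal.hor_hunit B) (T.cell φ))
      (T.mapCompanionUnit ψ) where
  unit_vcomp_counit := by
    -- The identities are restated as equations between honest cells, since `T` acts on these only.
    have e : vcomp ψ φ = recast rfl (Category.id_comp j).symm (Category.comp_id j).symm rfl
        (cunit j) := of_injective (by rw [of_vcomp, h.unit_vcomp_counit, of_recast])
    rw [mapCompanionUnit, of_recast, of_recast, ← of_cell_vcomp, e, of_cell_recast, of_cell_cunit]
  unit_hcomp_counit := by
    have e : pre (leftUnitorInv J) (post (ccomp ψ φ) (rightUnitor J)) = vid J :=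
      of_injective (by rw [of_pre, of_post, of_ccomp, h.unit_hcomp_counit])
    rw [mapCompanionUnit, of_recast, of_recast, ← compositor_rightUnitor, ← vcomp_assoc (hcomp _ _),
      compositor_naturality', vcomp_assoc, ← vcomp_assoc, leftUnitorInv_compositor,
      ← of_cell_vid, ← e, pre, post, of_cell_recast, of_cell_vcomp, of_cell_recast, of_cell_vcomp]

end NormalLaxDoubleMonad

end DoubleCategory

/-! ### The main theorem -/

open DoubleCategoryStruct DoubleCategory in
theorem mainTheorem3 {K : Type u} [DoubleCategory.{z, w, v} K] (hK : IsEquipment K)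
    (T : NormalLaxDoubleMonad K) (hT : T.IsColaxIdempotent)
    {A B M : K} (X : T.PseudoAlgebra A) (Y : T.PseudoAlgebra B) (Z : T.PseudoAlgebra M)
    (j : A ⟶ B) (d : A ⟶ M) (l : B ⟶ M)
    (jstar : Hor A B) (jcart : Cell jstar j (𝟙 B) (hunit B)) (hj : IsCompanion j jstar jcart)
    (η : Cell jstar d l (hunit M)) (hη : IsPointwiseLeftKan η) :
    (∃! dbar : VCell (X.act ≫ d) (T.map d ≫ Z.act),
        NormalLaxDoubleMonad.IsColaxMorphism X Z d dbar) ∧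
      (∃! lbar : VCell (Y.act ≫ l) (T.map l ≫ Z.act),
        NormalLaxDoubleMonad.IsColaxMorphism Y Z l lbar) ∧
      ∀ (dbar : VCell (X.act ≫ d) (T.map d ≫ Z.act))
        (lbar : VCell (Y.act ≫ l) (T.map l ≫ Z.act)),
        NormalLaxDoubleMonad.IsColaxMorphism X Z d dbar →
        NormalLaxDoubleMonad.IsColaxMorphism Y Z l lbar →
        VCell.IsInvertible dbar →
        (VCell.IsInvertible lbar ↔ IsLeftKan (vcomp (T.mapToUnit η) (cunit Z.act))) := by
  refine ⟨NormalLaxDoubleMonad.existsUnique_isColaxMorphism hT X Z d,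
    NormalLaxDoubleMonad.existsUnique_isColaxMorphism hT Y Z l, fun dbar lbar hd hl hi => ?_⟩
  obtain ⟨ψ, hψ⟩ := hj.exists_isCompanionPair
  -- Transposing along the image of `ψ` turns the right-hand side into a vertical Kan extension; by
  -- functoriality of `T` the transposed cell is the image of the transpose of `η`, whiskered with
  -- `Z.act`.
  rw [(T.map_isCompanionPair hψ).isLeftKan_iff]
  refine NormalLaxDoubleMonad.isInvertible_iff_isLeftKan_map hT X Y Z
    ((hψ.isLeftKan_iff η).1 hη.isLeftKan) hd hl hi ?_
  rw [← NormalLaxDoubleMonad.of_mapV_eq, ← TwoCell.of_whiskerRight]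
  refine TwoCell.of_congr rfl (by rw [T.map_comp, Category.assoc]) ?_
  rw [of_companionTranspose, VCell.of_whiskerRight, T.of_mapV, companionTranspose,
    NormalLaxDoubleMonad.of_cell_recast, T.of_cell_vcomp, NormalLaxDoubleMonad.mapCompanionUnit,
    PCell.of_recast, PCell.of_vcomp, NormalLaxDoubleMonad.mapToUnit, PCell.of_recast,
    PCell.vcomp_assoc]
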